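/- Let $d\ge 1$ be an integer and $1\le p<\infty$. Notation. For a kernel $\nu:\mathbb R^d\setminus\{0\}\to[0,\infty]$ put $|u|_{W^p_\nu}=\big(\iint_{\mathbb R^d\times\mathbb R^d}|u(x)-u(y)|^p\nu(x-y)\,dy\,dx\big)^{1/p}$, and let $W^p_\nu(\mathbb R^d)=\{u\in L^p(\mathbb R^d): |u|_{W^p_\nu}<\infty\}$ with norm $(\|u\|_{L^p}^p+|u|_{W^p_\nu}^p)^{1/p}$. The space $W^{1,p}(\mathbb R^d)$ consists of the $u\in L^p$ with distributional gradient $\nabla u\in L^p$ and has the norm $(\|u\|_{L^p}^p+\|\nabla u\|_{L^p}^p)^{1/p}$. For $s\in(0,1)$, $W^{s,p}(\mathbb R^d)$ is $W^p_\nu(\mathbb R^d)$ with $\nu(h)=|h|^{-d-sp}$. A Young function is a convex function $\psi:[0,\infty]\to[0,\infty]$ with $\psi(0)=0$; the Orlicz space $L^\psi(\mathbb R^d)$ consists of the measurable $u$ with $\int_{\mathbb R^d}\psi(|u|/\lambda)\,dx<\infty$ for some $\lambda>0$ and has the Luxemburg norm $\|u\|_{L^\psi}=\inf\{\lambda>0:\int_{\mathbb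 R^d}\psi(|u|/\lambda)\,dx\le 1\}$. Let $c_d=|B(0,1)|$ and $\eta(r)=(r/c_d)^{1/d}$. For measurable $\nu$ let $\nu^*(\rho)=\inf\{\sigma>0: |\{\nu>\sigma\}|\le c_d\rho^d\}$ be the radial profile of its symmetric decreasing rearrangement, let $\nu^\#(r)=\int_{\{\nu<\nu^*(\eta(r))\}}\nu(h)\,dh$, and define $w:[0,\infty]\to[0,\infty]$ by $w(r)=(r\,\nu^\#(r))^{1/p}$ for $0<r<\infty$, $w(0)=0$, $w(\infty)=\infty$. (1) Let $\nu:\mathbb R^d\setminus\{0\}\to[0,\infty]$ be measurable with $\int_{\mathbb R^d}\min(1,|h|^p)\,\nu(h)\,dh<\infty$. Assume that $w$ is a bijection of $[0,\infty]$, and let $\phi(t)=1/w^{-1}(1/t)$ (with $1/0=\infty$, $1/\infty=0$). Assume that $t\mapsto\phi(t^{1/p})$ is a Young function and that there is $\theta>0$ with $\phi(\theta s/t)\le\phi(s)/\phi(t)$ for all $0\le s\le t$ with $0<t<\infty$. Then for every Young function $\psi$ for which there is a constant $c>0$ with $\psi(ct)\le\max(t^p,\phi(t))$ for all $t>0$,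 the embeddings $W^p_\nu(\mathbb R^d)\hookrightarrow L^\psi(\mathbb R^d)$ and $W^{1,p}(\mathbb R^d)\hookrightarrow L^\psi(\mathbb R^d)$ hold and are continuous. (2) In particular, let $s\in(0,1)$ with $\frac1p-\frac sd>0$ and define $p^*_s$ by $\frac1{p^*_s}=\frac1p-\frac sd$. Then for every $q\in[p,p^*_s]$ the embedding $W^{s,p}(\mathbb R^d)\hookrightarrow L^q(\mathbb R^d)$ holds and is continuous. -/

import Mathlib

open MeasureTheory
open scoped ENNReal NNReal

noncomputable section

namespace NonlocalSobolev

/-- The Euclidean space `ℝ^d`. -/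
abbrev Rd (d : ℕ) : Type := EuclideanSpace ℝ (Fin d)

/-! ### Young functions and Orlicz spaces -/

/-- A Young function: a convex function `ψ : [0,∞] → [0,∞]` with `ψ 0 = 0`. -/
def IsYoungFunction (ψ : ℝ≥0∞ → ℝ≥0∞) : Prop :=
  ConvexOn ℝ≥0 Set.univ ψ ∧ ψ 0 = 0

/-- The modular `∫ ψ(|u(x)| / k) dx`. -/
def modular {d : ℕ} (ψ : ℝ≥0∞ → ℝ≥0∞) (u : Rd d → ℝ) (k : ℝ≥0) : ℝ≥0∞ :=
  ∫⁻ x, ψ (‖u x‖ₑ / (k : ℝ≥0∞))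

/-- Membership in the Orlicz space `L^ψ(ℝ^d)`. -/
def MemOrlicz {d : ℕ} (ψ : ℝ≥0∞ → ℝ≥0∞) (u : Rd d → ℝ) : Prop :=
  AEStronglyMeasurable u volume ∧ ∃ k : ℝ≥0, 0 < k ∧ modular ψ u k < ∞

/-- The Luxemburg norm `inf {k > 0 : ∫ ψ(|u|/k) ≤ 1}`, with value in `[0,∞]`. -/
def luxemburgNorm {d : ℕ} (ψ : ℝ≥0∞ → ℝ≥0∞) (u : Rd d → ℝ) : ℝ≥0∞ :=
  ⨅ (k : ℝ≥0) (_ : 0 < k ∧ modular ψ u k ≤ 1), (k : ℝ≥0∞)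

/-! ### Nonlocal and local Sobolev spaces

A kernel on `ℝ^d \ {0}` is represented by a function on `ℝ^d`; its value at the origin plays no
role, since the origin is a null set for `d ≥ 1`. -/

/-- The `p`-Lévy integrability `∫ min(1, |h|^p) ν(h) dh < ∞`. -/
def IsLevyIntegrable {d : ℕ} (p : ℝ) (ν : Rd d → ℝ≥0∞) : Prop :=
  ∫⁻ h, min 1 (‖h‖ₑ ^ p) * ν h < ∞

/-- The seminorm `(∬ |u(x) - u(y)|^p ν(x - y) dy dx)^{1/p}`, with value in `[0,∞]`. -/
def nonlocalSeminorm {d : ℕ} (p : ℝ) (ν : Rd d → ℝ≥0∞) (u : Rd d → ℝ) : ℝ≥0∞ :=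
  (∫⁻ x, ∫⁻ y, ‖u x - u y‖ₑ ^ p * ν (x - y)) ^ (1 / p)

/-- Membership in `W_ν^p(ℝ^d)`. -/
def MemNonlocal {d : ℕ} (p : ℝ) (ν : Rd d → ℝ≥0∞) (u : Rd d → ℝ) : Prop :=
  MemLp u (ENNReal.ofReal p) volume ∧ nonlocalSeminorm p ν u < ∞

/-- The norm `(‖u‖_{L^p}^p + |u|_{W_ν^p}^p)^{1/p}` of `W_ν^p(ℝ^d)`. -/
def nonlocalNorm {d : ℕ} (p : ℝ) (ν : Rd d → ℝ≥0∞) (u : Rd d → ℝ) : ℝ≥0∞ :=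
  (eLpNorm u (ENNReal.ofReal p) volume ^ p + nonlocalSeminorm p ν u ^ p) ^ (1 / p)

/-- `g` is the distributional gradient of `u`:
`∫ u ∂_i η = - ∫ g_i η` for all test functions `η` and all `i`.
(Used only for `u` and `g` in `L^p`, which are locally integrable.) -/
def IsWeakGradient {d : ℕ} (u : Rd d → ℝ) (g : Rd d → Rd d) : Prop :=
  ∀ η : Rd d → ℝ, ContDiff ℝ ((⊤ : ℕ∞) : WithTop ℕ∞) η → HasCompactSupport η → ∀ i : Fin d,
    ∫ x, u x * fderiv ℝ η x (EuclideanSpace.single i 1) = - ∫ x, g x i * η x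

/-- Membership in the classical Sobolev space `W^{1,p}(ℝ^d)`. -/
def MemSobolevOne {d : ℕ} (p : ℝ) (u : Rd d → ℝ) : Prop :=
  MemLp u (ENNReal.ofReal p) volume ∧
    ∃ g : Rd d → Rd d, MemLp g (ENNReal.ofReal p) volume ∧ IsWeakGradient u g

/-- The norm `(‖u‖_{L^p}^p + ‖∇u‖_{L^p}^p)^{1/p}` of `W^{1,p}(ℝ^d)`. The gradient is unique up to
a null set, so that the infimum is over a single value if `u ∈ W^{1,p}(ℝ^d)`. -/
def sobolevOneNorm {d : ℕ} (p : ℝ) (u : Rd d → ℝ) : ℝ≥0∞ :=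
  ⨅ (g : Rd d → Rd d) (_ : MemLp g (ENNReal.ofReal p) volume ∧ IsWeakGradient u g),
    (eLpNorm u (ENNReal.ofReal p) volume ^ p + eLpNorm g (ENNReal.ofReal p) volume ^ p) ^ (1 / p)

/-- The kernel `|h|^{-d-sp}`, for which `W_ν^p(ℝ^d) = W^{s,p}(ℝ^d)`. -/
def fractionalKernel (d : ℕ) (s p : ℝ) (h : Rd d) : ℝ≥0∞ :=
  ‖h‖ₑ ^ (-((d : ℝ) + s * p))

/-- The space of functions `X` with norm `normX` is contained in `Y` with norm `normY`, and the
inclusion is continuous. -/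
def ContinuouslyEmbeds {d : ℕ} (X : (Rd d → ℝ) → Prop) (normX : (Rd d → ℝ) → ℝ≥0∞)
    (Y : (Rd d → ℝ) → Prop) (normY : (Rd d → ℝ) → ℝ≥0∞) : Prop :=
  (∀ u, X u → Y u) ∧ ∃ C : ℝ≥0, ∀ u, X u → normY u ≤ C * normX u

/-! ### The critical function of a kernel -/

/-- `c_d = |B(0,1)|`. -/
def unitBallVolume (d : ℕ) : ℝ≥0∞ := volume (Metric.ball (0 : Rd d) 1)

/-- `η(r) = (r / c_d)^{1/d}`, the radius of a ball of volume `r`. -/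
def ballRadius (d : ℕ) (r : ℝ≥0∞) : ℝ≥0∞ := (r / unitBallVolume d) ^ (1 / (d : ℝ))

/-- The symmetric decreasing rearrangement of `ν` as a function of the radius `ρ = |x|`:
`ν^*(ρ) = inf {s > 0 : |{ν > s}| ≤ c_d ρ^d}`. -/
def symmRearrangement {d : ℕ} (ν : Rd d → ℝ≥0∞) (ρ : ℝ≥0∞) : ℝ≥0∞ :=
  sInf {s : ℝ≥0∞ | 0 < s ∧ volume {h : Rd d | s < ν h} ≤ unitBallVolume d * ρ ^ d}

/-- `ν^#(r) = ∫_{ν < ν^*(η(r))} ν(h) dh`. -/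
def sharp {d : ℕ} (ν : Rd d → ℝ≥0∞) (r : ℝ≥0∞) : ℝ≥0∞ :=
  ∫⁻ h in {h : Rd d | ν h < symmRearrangement ν (ballRadius d r)}, ν h

open Classical in
/-- `w(r) = (r ν^#(r))^{1/p}` for `0 ≤ r < ∞`, extended by `w(∞) = ∞`. At `r = 0` the product is
`0`, by the convention `0 * ∞ = 0`. -/
def wFun {d : ℕ} (p : ℝ) (ν : Rd d → ℝ≥0∞) (r : ℝ≥0∞) : ℝ≥0∞ :=
  if r = ∞ then ∞ else (r * sharp ν r) ^ (1 / p)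

/-- The critical function `φ(t) = 1 / w⁻¹(1/t)` (with `1/0 = ∞` and `1/∞ = 0`), where `w⁻¹` is the
inverse of the bijection `w : [0,∞] → [0,∞]`. -/
def criticalFunction {d : ℕ} (p : ℝ) (ν : Rd d → ℝ≥0∞) (t : ℝ≥0∞) : ℝ≥0∞ :=
  (Function.invFun (wFun p ν) t⁻¹)⁻¹

end NonlocalSobolev

end

open NonlocalSobolev

/-! The core is a level set argument. Suppose ∫ φ(|u|/k) ≤ 1, put t = |u(x)|/(2k) and E = {|u| >
|u(x)|/2}. Chebyshev gives |E| ≤ 1/φ(t), and |u(x) - u(y)| ≥ |u(x)|/2 = kt off E. Hence ∫ |u(x) -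
u(y)|^p ν(x - y) dy is at least k^p t^p ∫_{Eᶜ} ν(x - y) dy. By the bathtub principle this last
integral is at least ν^#(1/φ(t)), and the definition of φ through w⁻¹ says precisely that φ(t) = t^p
ν^#(1/φ(t)). Integrating in x gives k^p ∫ φ(|u|/(2k)) ≤ energy
(`IsSobolevGrowth.mul_lintegral_le_energy`).

This estimate needs ∫ φ(|u|/k) ≤ 1 beforehand, but it improves itself: with the doubling property of
φ, a bound at 2k becomes a bound at k as long as k^p dominates a multiple of the energy. For
truncations of |u| the modular is finite, hence at most 1 at scale 2^n k for large n; one descends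
to k and removes the truncation by monotone convergence. Convexity of ψ then passes from the φ- and
L^p-modulars to ψ.

`IsSobolevGrowth` isolates what is used of φ. It holds for the critical function, and directly for
powers with the fractional kernel, so part (2) does not go through w.

For W^{1,p}, a weakly differentiable u satisfies ‖u - u(· - h)‖_p ≤ |h| ‖∇u‖_p; together with the
trivial bound 2‖u‖_p and Lévy integrability this embeds W^{1,p} into W_ν^p. -/

namespace NonlocalSobolev

/-! ### Bathtub principle and the function ν^# -/

/-- Bathtub principle: among the sets `Eᶜ` with `|E| ≤ |{f > s}|`, the integral of `f` is at least
its integral over the sublevel set `{f ≤ s}`. -/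
theorem setLIntegral_le_setLIntegral_compl {α : Type*} [MeasurableSpace α] {μ : Measure α}
    {f : α → ℝ≥0∞} (hf : Measurable f) {E : Set α} (hE : MeasurableSet E) (hE' : μ E ≠ ∞)
    {s : ℝ≥0∞} (h : μ E ≤ μ {x | s < f x}) :
    ∫⁻ x in {x | f x ≤ s}, f x ∂μ ≤ ∫⁻ x in Eᶜ, f x ∂μ := by
  set A : Set α := {x | s < f x} with hA
  have hAm : MeasurableSet A := measurableSet_lt measurable_const hf
  have hAc : {x | f x ≤ s} = Aᶜ := by ext x; simp [hA]
  -- Cancelling the finite measure of E ∩ A reduces everything to the exchange of E \ A, where f ≤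
  -- s, for A \ E, where f > s.
  have hmeas : μ (E \ A) ≤ μ (A \ E) := by
    rw [← measure_inter_add_sdiff E hAm, ← measure_inter_add_sdiff A hE, Set.inter_comm A E] at h
    exact (ENNReal.add_le_add_iff_left
      (ne_top_of_le_ne_top hE' (measure_mono Set.inter_subset_left))).1 h
  have h1 : ∫⁻ x in E \ A, f x ∂μ ≤ s * μ (E \ A) := by
    rw [← setLIntegral_const]
    exact setLIntegral_mono measurable_const fun x hx => not_lt.1 hx.2
  have h2 : s * μ (A \ E) ≤ ∫⁻ x in A \ E, f x ∂μ := by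
    rw [← setLIntegral_const]
    exact setLIntegral_mono hf fun x hx => le_of_lt hx.1
  rw [hAc, ← lintegral_inter_add_sdiff f Aᶜ hE, ← lintegral_inter_add_sdiff f Eᶜ hAm,
    Set.inter_comm Aᶜ, Set.inter_comm Eᶜ, ← Set.sdiff_eq, ← Set.sdiff_eq,
    Set.sdiff_eq_compl_inter (s := Aᶜ), Set.sdiff_eq_compl_inter (s := Eᶜ), Set.inter_comm Eᶜ]
  refine add_le_add ?_ le_rfl
  exact h1.trans ((mul_le_mul_right hmeas s).trans h2)

theorem unitBallVolume_mul_ballRadius_pow {d : ℕ} (hd : 1 ≤ d) (r : ℝ≥0∞) :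
    unitBallVolume d * ballRadius d r ^ d = r := by
  have hd' : (d : ℝ) ≠ 0 := by positivity
  have h0 : unitBallVolume d ≠ 0 := (Metric.measure_ball_pos volume _ one_pos).ne'
  have h1 : unitBallVolume d ≠ ∞ := measure_ball_lt_top.ne
  rw [ballRadius, ← ENNReal.rpow_natCast, ← ENNReal.rpow_mul, one_div, inv_mul_cancel₀ hd',
    ENNReal.rpow_one, ENNReal.mul_div_cancel h0 h1]

/-- The bathtub principle cannot be applied at the level σ = ν^*(η(r)) itself, since {ν > σ} may be
smaller than E. Every level a < σ fails the condition defining the infimum, so |{ν > a}| > r ≥ |E|;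
letting a increase to σ exhausts {ν < σ}. -/
theorem sharp_le_setLIntegral_compl {d : ℕ} (hd : 1 ≤ d) {ν : Rd d → ℝ≥0∞} (hν : Measurable ν)
    {E : Set (Rd d)} (hE : MeasurableSet E) {r : ℝ≥0∞} (hr : r ≠ ∞) (hEr : volume E ≤ r) :
    sharp ν r ≤ ∫⁻ h in Eᶜ, ν h := by
  rw [sharp]
  set σ := symmRearrangement ν (ballRadius d r) with hσ
  rcases eq_or_ne σ 0 with h0 | h0
  · simp [h0]
  obtain ⟨a, ha, ha', hlim⟩ := exists_seq_strictMono_tendsto' (pos_iff_ne_zero.2 h0)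
  have hunion : {h : Rd d | ν h < σ} = ⋃ n, {h | ν h ≤ a n} := by
    ext h
    simp only [Set.mem_ofPred_eq, Set.mem_iUnion]
    constructor
    · intro hh
      obtain ⟨n, hn⟩ := (hlim.eventually (lt_mem_nhds hh)).exists
      exact ⟨n, hn.le⟩
    · rintro ⟨n, hn⟩
      exact hn.trans_lt (ha' n).2
  rw [hunion, setLIntegral_iUnion_of_directed]
  · refine iSup_le fun n => setLIntegral_le_setLIntegral_compl hν hE (ne_top_of_le_ne_top hr hEr) ?_
    have hn : a n ∉ {s : ℝ≥0∞ | 0 < s ∧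
        volume {h : Rd d | s < ν h} ≤ unitBallVolume d * ballRadius d r ^ d} :=
      fun hmem => (ha' n).2.not_ge (sInf_le hmem)
    rw [unitBallVolume_mul_ballRadius_pow hd] at hn
    simp only [Set.mem_ofPred_eq, not_and, not_le] at hn
    exact hEr.trans (hn (ha' n).1).le
  · exact Monotone.directed_le fun m n hmn h hh => le_trans hh (ha.monotone hmn)

/-- The set is x - E. Since only its measure matters later, ν need not be even. -/
theorem exists_reflected_set {d : ℕ} {ν : Rd d → ℝ≥0∞} (hν : Measurable ν)
    {E : Set (Rd d)} (hE : MeasurableSet E) (x : Rd d) :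
    ∃ E' : Set (Rd d), MeasurableSet E' ∧ volume E' = volume E ∧
      ∫⁻ y in Eᶜ, ν (x - y) = ∫⁻ h in E'ᶜ, ν h := by
  have hmp : MeasurePreserving (fun y : Rd d => x - y) := Measure.measurePreserving_sub_left volume x
  refine ⟨(fun y => x - y) ⁻¹' E, hmp.measurable hE, hmp.measure_preimage hE.nullMeasurableSet, ?_⟩
  rw [← hmp.setLIntegral_comp_preimage (hmp.measurable hE).compl hν]
  congr 2
  ext y; simp

/-! ### The level set argument -/

/-- The conditions on a function `φ` under which the level set argument bounds the `φ`-modular by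
the energy with kernel `ν`. -/
structure IsSobolevGrowth {d : ℕ} (p : ℝ) (ν : Rd d → ℝ≥0∞) (φ : ℝ≥0∞ → ℝ≥0∞) (A K : ℝ≥0) :
    Prop where
  mono : Monotone φ
  zero : φ 0 = 0
  lt_top : ∀ t, t < ∞ → φ t < ∞
  doubling : ∀ t, t < ∞ → φ t ≤ A * φ (t / 2)
  scale : ∀ a t, a ≤ 1 → t < ∞ → φ (a * t) ≤ a ^ p * φ t
  pos : 0 < K
  lower : ∀ (x : Rd d) (E : Set (Rd d)) (t : ℝ≥0∞), MeasurableSet E → 0 < t → t < ∞ →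
    volume E ≤ (φ t)⁻¹ → K * φ t ≤ t ^ p * ∫⁻ y in Eᶜ, ν (x - y)

/-- The energy `∬ |u(x) - u(y)|^p ν(x - y) dy dx`. -/
noncomputable def energy {d : ℕ} (p : ℝ) (ν : Rd d → ℝ≥0∞) (u : Rd d → ℝ) : ℝ≥0∞ :=
  ∫⁻ x, ∫⁻ y, ‖u x - u y‖ₑ ^ p * ν (x - y)

namespace IsSobolevGrowth

variable {d : ℕ} {p : ℝ} {ν : Rd d → ℝ≥0∞} {φ : ℝ≥0∞ → ℝ≥0∞} {A K : ℝ≥0}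
  {u : Rd d → ℝ} {v : Rd d → ℝ≥0∞} {k : ℝ≥0}

/-- The level set estimate, for v a truncation of |u|: the hypothesis `huv` allows comparison with
the energy of u itself, so the energy of the truncation never appears. -/
theorem mul_lintegral_le_energy (hφ : IsSobolevGrowth p ν φ A K) (hp : 0 ≤ p)
    (hv : Measurable v) (hvtop : ∀ x, v x < ∞) (huv : ∀ x y, v x ≤ v y + ‖u x - u y‖ₑ)
    (hk : 0 < k) (h1 : ∫⁻ x, φ (v x / k) ≤ 1) :
    K * (k : ℝ≥0∞) ^ p * ∫⁻ x, φ (v x / (2 * k)) ≤ energy p ν u := by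
  have hk0 : (k : ℝ≥0∞) ≠ 0 := by exact_mod_cast hk.ne'
  refine (lintegral_const_mul_le _ _).trans (lintegral_mono fun x => ?_)
  rcases eq_or_ne (v x) 0 with h0 | h0
  · simp [h0, hφ.zero]
  set t := v x / (2 * k) with ht
  have hkt : k * t = v x / 2 := by
    rw [ht, ← mul_div_assoc, mul_comm (k : ℝ≥0∞), ENNReal.mul_div_mul_right _ _ hk0 (by simp)]
  set E : Set (Rd d) := {y | v x / 2 < v y} with hEdef
  have hE : MeasurableSet E := measurableSet_lt measurable_const hv
  have htk : v x / 2 / k = t := by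
    rw [← hkt, mul_div_assoc, mul_comm, ENNReal.div_mul_cancel hk0 (by simp)]
  -- Chebyshev's inequality: v / k ≥ t on E and the modular at k is at most 1.
  have hEv : volume E ≤ (φ t)⁻¹ := by
    rw [ENNReal.le_inv_iff_mul_le, mul_comm]
    refine le_trans ?_ ((mul_meas_ge_le_lintegral
      (hφ.mono.measurable.comp (hv.div_const (k : ℝ≥0∞))) (φ t)).trans h1)
    gcongr
    intro y hy
    refine hφ.mono ?_
    rw [← htk]
    exact ENNReal.div_le_div_right (le_of_lt hy) _
  have hlow := hφ.lower x E t hE (ENNReal.div_pos h0 (by finiteness))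
    (ENNReal.div_lt_top (hvtop x).ne (by simp [hk0])) hEv
  calc K * (k : ℝ≥0∞) ^ p * φ t = (k : ℝ≥0∞) ^ p * (K * φ t) := by ring
    _ ≤ (k : ℝ≥0∞) ^ p * (t ^ p * ∫⁻ y in Eᶜ, ν (x - y)) := by gcongr
    _ = (v x / 2) ^ p * ∫⁻ y in Eᶜ, ν (x - y) := by
        rw [← mul_assoc, ← ENNReal.mul_rpow_of_nonneg _ _ hp, hkt]
    _ ≤ ∫⁻ y in Eᶜ, (v x / 2) ^ p * ν (x - y) := lintegral_const_mul_le _ _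
    _ ≤ ∫⁻ y in Eᶜ, ‖u x - u y‖ₑ ^ p * ν (x - y) := by
        -- Off E, v y ≤ v x / 2, so `huv` leaves at least v x / 2 for the difference of u.
        refine setLIntegral_mono' hE.compl fun y hy => ?_
        gcongr
        have hy' : v y ≤ v x / 2 := not_lt.1 hy
        have h2 := huv x y
        rw [← ENNReal.add_halves (v x)] at h2
        exact (ENNReal.add_le_add_iff_left (ENNReal.div_lt_top (hvtop x).ne two_ne_zero).ne).1
          (h2.trans (by gcongr))
    _ ≤ ∫⁻ y, ‖u x - u y‖ₑ ^ p * ν (x - y) := setLIntegral_le_lintegral _ _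

/-- Descent from 2^n k to k by halving. A bound at 2k feeds the level set estimate, which controls
the modular at 4k by the energy; two doublings bring it back to k, whence the factor A². -/
theorem lintegral_le_one_of_pow (hφ : IsSobolevGrowth p ν φ A K) (hp : 0 ≤ p)
    (hv : Measurable v) (hvtop : ∀ x, v x < ∞) (huv : ∀ x y, v x ≤ v y + ‖u x - u y‖ₑ)
    (n : ℕ) : ∀ k : ℝ≥0, 0 < k → A ^ 2 * energy p ν u ≤ K * (k : ℝ≥0∞) ^ p →
      ∫⁻ x, φ (v x / (2 ^ n * k : ℝ≥0)) ≤ 1 → ∫⁻ x, φ (v x / k) ≤ 1 := by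
  induction n with
  | zero => intro k hk _ h; simpa using h
  | succ n ih =>
    intro k hk hS h
    have hk0 : (k : ℝ≥0∞) ≠ 0 := by exact_mod_cast hk.ne'
    have hle : (k : ℝ≥0∞) ≤ (2 * k : ℝ≥0) := by
      exact_mod_cast le_mul_of_one_le_left (zero_le) one_le_two
    have hS2 : A ^ 2 * energy p ν u ≤ K * ((2 * k : ℝ≥0) : ℝ≥0∞) ^ p := hS.trans (by gcongr)
    have h2 : ∫⁻ x, φ (v x / (2 * k : ℝ≥0)) ≤ 1 := by
      refine ih (2 * k) (by positivity) hS2 ?_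
      rwa [← mul_assoc, ← pow_succ]
    have h4 := hφ.mul_lintegral_le_energy hp hv hvtop huv (k := 2 * k) (by positivity) h2
    have hdoub : ∫⁻ x, φ (v x / k) ≤
        A ^ 2 * ∫⁻ x, φ (v x / (2 * ((2 * k : ℝ≥0) : ℝ≥0∞))) := by
      rw [← lintegral_const_mul' _ _ (by finiteness)]
      refine lintegral_mono fun x => ?_
      have hlt : v x / k < ∞ := ENNReal.div_lt_top (hvtop x).ne hk0
      have e : v x / (2 * ((2 * k : ℝ≥0) : ℝ≥0∞)) = v x / k / 2 / 2 := by
        push_cast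
        simp only [div_eq_mul_inv]
        rw [ENNReal.mul_inv (by simp) (by simp), ENNReal.mul_inv (by simp) (by simp)]
        ring
      rw [e, pow_two, mul_assoc]
      refine (hφ.doubling _ hlt).trans ?_
      gcongr
      exact hφ.doubling _ (ENNReal.div_lt_top hlt.ne two_ne_zero)
    have hc0 : (K : ℝ≥0∞) * ((2 * k : ℝ≥0) : ℝ≥0∞) ^ p ≠ 0 := by
      refine mul_ne_zero (by exact_mod_cast hφ.pos.ne') ?_
      exact (ENNReal.rpow_pos (by simpa using hk) ENNReal.coe_ne_top).ne'
    have hc1 : (K : ℝ≥0∞) * ((2 * k : ℝ≥0) : ℝ≥0∞) ^ p ≠ ∞ := by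
      refine ENNReal.mul_ne_top (by simp) (ENNReal.rpow_ne_top_of_nonneg hp ENNReal.coe_ne_top)
    refine (ENNReal.mul_le_mul_iff_right hc0 hc1).1 ?_
    rw [mul_one]
    refine le_trans ?_ hS2
    calc _ ≤ (K : ℝ≥0∞) * ((2 * k : ℝ≥0) : ℝ≥0∞) ^ p *
          (A ^ 2 * ∫⁻ x, φ (v x / (2 * ((2 * k : ℝ≥0) : ℝ≥0∞)))) := by gcongr
      _ = A ^ 2 * ((K : ℝ≥0∞) * ((2 * k : ℝ≥0) : ℝ≥0∞) ^ p *
          ∫⁻ x, φ (v x / (2 * ((2 * k : ℝ≥0) : ℝ≥0∞)))) := by ring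
      _ ≤ _ := by gcongr

/-- A finite modular is at most 1 at some scale 2^n k, because φ(2^{-n} t) ≤ 2^{-np} φ(t) ≤ 2^{-n}
φ(t); this starts the descent. -/
theorem lintegral_le_one (hφ : IsSobolevGrowth p ν φ A K) (hp : 1 ≤ p)
    (hv : Measurable v) (hvtop : ∀ x, v x < ∞) (huv : ∀ x y, v x ≤ v y + ‖u x - u y‖ₑ)
    (hk : 0 < k) (hS : A ^ 2 * energy p ν u ≤ K * (k : ℝ≥0∞) ^ p)
    (hfin : ∫⁻ x, φ (v x / k) < ∞) : ∫⁻ x, φ (v x / k) ≤ 1 := by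
  have hk0 : (k : ℝ≥0∞) ≠ 0 := by exact_mod_cast hk.ne'
  obtain ⟨n, hn⟩ := ENNReal.exists_nat_gt hfin.ne
  refine hφ.lintegral_le_one_of_pow (by linarith) hv hvtop huv n k hk hS ?_
  have hpow : ((2 : ℝ≥0∞) ^ n)⁻¹ ≤ 1 := by
    rw [ENNReal.inv_le_one]; exact one_le_pow₀ (by norm_num)
  calc ∫⁻ x, φ (v x / (2 ^ n * k : ℝ≥0)) ≤ ∫⁻ x, ((2 : ℝ≥0∞) ^ n)⁻¹ * φ (v x / k) := by
        refine lintegral_mono fun x => ?_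
        have e : v x / (2 ^ n * k : ℝ≥0) = ((2 : ℝ≥0∞) ^ n)⁻¹ * (v x / k) := by
          push_cast
          simp only [div_eq_mul_inv]
          rw [ENNReal.mul_inv (by simp) (by simp)]
          ring
        rw [e]
        refine (hφ.scale _ _ hpow (ENNReal.div_lt_top (hvtop x).ne hk0)).trans ?_
        gcongr
        exact ENNReal.rpow_le_self_of_le_one hpow hp
    _ = ((2 : ℝ≥0∞) ^ n)⁻¹ * ∫⁻ x, φ (v x / k) := by
        rw [lintegral_const_mul' _ _ (by simp)]
    _ ≤ ((2 : ℝ≥0∞) ^ n)⁻¹ * 2 ^ n := by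
        gcongr
        refine hn.le.trans ?_
        exact_mod_cast Nat.lt_two_pow_self.le
    _ ≤ 1 := ENNReal.inv_mul_le_one _

theorem modular_le_one_of_measurable (hφ : IsSobolevGrowth p ν φ A K) (hp : 1 ≤ p)
    (hu : Measurable u) (hup : ∫⁻ x, ‖u x‖ₑ ^ p < ∞) (hk : 0 < k)
    (hS : A ^ 2 * energy p ν u ≤ K * (k : ℝ≥0∞) ^ p) : modular φ u k ≤ 1 := by
  have hp0 : 0 ≤ p := by linarith
  have hk0 : (k : ℝ≥0∞) ≠ 0 := by exact_mod_cast hk.ne'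
  -- Truncation at n + 1 makes the φ-modular finite: v ≤ n + 1 and the scaling of φ bound φ(v / k)
  -- by a multiple of |u|^p.
  set v : ℕ → Rd d → ℝ≥0∞ := fun n x => min ‖u x‖ₑ (n + 1) with hvdef
  have hv : ∀ n, Measurable (v n) := fun n => hu.enorm.min measurable_const
  have hvtop : ∀ n x, v n x < ∞ := fun n x => (min_le_left _ _).trans_lt (by finiteness)
  have huv : ∀ n x y, v n x ≤ v n y + ‖u x - u y‖ₑ := by
    intro n x y
    have : ‖u x‖ₑ ≤ ‖u y‖ₑ + ‖u x - u y‖ₑ := by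
      simpa using enorm_add_le (u y) (u x - u y)
    simp only [hvdef]
    rw [← min_add_add_right]
    exact min_le_min this le_self_add
  have hone : ∀ n, ∫⁻ x, φ (v n x / k) ≤ 1 := by
    intro n
    refine hφ.lintegral_le_one hp (hv n) (hvtop n) (huv n) hk hS ?_
    have hn0 : (n + 1 : ℝ≥0∞) ≠ 0 := by simp
    have hntop : (n + 1 : ℝ≥0∞) ≠ ∞ := by finiteness
    have hlt : (n + 1 : ℝ≥0∞) / k < ∞ := ENNReal.div_lt_top hntop hk0
    calc ∫⁻ x, φ (v n x / k)
        ≤ ∫⁻ x, ((n + 1 : ℝ≥0∞)⁻¹ ^ p * φ ((n + 1) / k)) * ‖u x‖ₑ ^ p := by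
          refine lintegral_mono fun x => ?_
          have e : v n x / k = (n + 1 : ℝ≥0∞)⁻¹ * v n x * ((n + 1) / k) := by
            simp only [div_eq_mul_inv]
            calc v n x * (k : ℝ≥0∞)⁻¹ = ((n + 1 : ℝ≥0∞)⁻¹ * (n + 1)) * (v n x * (k : ℝ≥0∞)⁻¹) := by
                  rw [ENNReal.inv_mul_cancel hn0 hntop, one_mul]
              _ = _ := by ring
          rw [e]
          refine (hφ.scale _ _ ?_ hlt).trans ?_
          · rw [ENNReal.inv_mul_le_iff hn0 hntop, mul_one]
            exact min_le_right _ _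
          · rw [ENNReal.mul_rpow_of_nonneg _ _ hp0, mul_right_comm]
            gcongr
            exact min_le_left _ _
      _ = ((n + 1 : ℝ≥0∞)⁻¹ ^ p * φ ((n + 1) / k)) * ∫⁻ x, ‖u x‖ₑ ^ p :=
          lintegral_const_mul _ (hu.enorm.pow_const p)
      _ < ∞ := ENNReal.mul_lt_top (ENNReal.mul_lt_top
          (ENNReal.rpow_lt_top_of_nonneg hp0 (by simp)) (hφ.lt_top _ hlt)) hup
  calc modular φ u k ≤ ∫⁻ x, ⨆ n, φ (v n x / k) := by
        refine lintegral_mono fun x => ?_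
        obtain ⟨n, hn⟩ := ENNReal.exists_nat_gt (enorm_ne_top (x := u x))
        have : v n x = ‖u x‖ₑ := min_eq_left (hn.le.trans le_self_add)
        exact le_iSup_of_le n (by rw [this])
    _ = ⨆ n, ∫⁻ x, φ (v n x / k) := by
        refine lintegral_iSup (fun n => hφ.mono.measurable.comp ((hv n).div_const _)) ?_
        intro m n hmn x
        refine hφ.mono (ENNReal.div_le_div_right (min_le_min_left _ ?_) _)
        gcongr
    _ ≤ 1 := iSup_le hone

end IsSobolevGrowth

theorem energy_congr {d : ℕ} {p : ℝ} {ν : Rd d → ℝ≥0∞} {u u' : Rd d → ℝ}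
    (h : u =ᵐ[volume] u') : energy p ν u = energy p ν u' := by
  refine lintegral_congr_ae ?_
  filter_upwards [h] with x hx
  refine lintegral_congr_ae ?_
  filter_upwards [h] with y hy
  rw [hx, hy]

theorem eLpNorm_rpow_eq_lintegral {α F : Type*} [MeasurableSpace α] {μ : Measure α}
    [NormedAddCommGroup F] {p : ℝ} (hp : 1 ≤ p) (f : α → F) :
    eLpNorm f (ENNReal.ofReal p) μ ^ p = ∫⁻ x, ‖f x‖ₑ ^ p ∂μ := by
  have hp0 : 0 < p := by linarith
  rw [eLpNorm_eq_lintegral_rpow_enorm_toReal (by simpa using hp0) (by simp),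
    ENNReal.toReal_ofReal hp0.le, ← ENNReal.rpow_mul, one_div, inv_mul_cancel₀ hp0.ne',
    ENNReal.rpow_one]

theorem nonlocalNorm_rpow {d : ℕ} {p : ℝ} (hp : 1 ≤ p) (ν : Rd d → ℝ≥0∞) (u : Rd d → ℝ) :
    nonlocalNorm p ν u ^ p = (∫⁻ x, ‖u x‖ₑ ^ p) + energy p ν u := by
  have hp0 : p ≠ 0 := by linarith
  rw [nonlocalNorm, ← ENNReal.rpow_mul, one_div, inv_mul_cancel₀ hp0, ENNReal.rpow_one,
    eLpNorm_rpow_eq_lintegral hp, nonlocalSeminorm, ← ENNReal.rpow_mul, one_div,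
    inv_mul_cancel₀ hp0, ENNReal.rpow_one, energy]

theorem IsSobolevGrowth.modular_le_one {d : ℕ} {p : ℝ} {ν : Rd d → ℝ≥0∞} {φ : ℝ≥0∞ → ℝ≥0∞}
    {A K : ℝ≥0} (hφ : IsSobolevGrowth p ν φ A K) (hp : 1 ≤ p) {u : Rd d → ℝ}
    (hu : MemLp u (ENNReal.ofReal p)) {k : ℝ≥0} (hk : 0 < k)
    (hS : A ^ 2 * energy p ν u ≤ K * (k : ℝ≥0∞) ^ p) : modular φ u k ≤ 1 := by
  have hae := hu.1.ae_eq_mk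
  have hlt : ∫⁻ x, ‖hu.1.mk u x‖ₑ ^ p < ∞ := by
    rw [← eLpNorm_rpow_eq_lintegral hp, ← eLpNorm_congr_ae hae]
    exact ENNReal.rpow_lt_top_of_nonneg (by linarith) hu.2.ne
  rw [energy_congr hae] at hS
  refine le_trans (le_of_eq (lintegral_congr_ae ?_))
    (hφ.modular_le_one_of_measurable hp hu.1.stronglyMeasurable_mk.measurable hlt hk hS)
  filter_upwards [hae] with x hx
  rw [hx]

/-- Above a fixed multiple of the norm of `u` in `W_ν^p`, both the `φ`-modular and the `L^p`-modular
of `u` are at most one. -/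
theorem IsSobolevGrowth.exists_const {d : ℕ} {p : ℝ} {ν : Rd d → ℝ≥0∞} {φ : ℝ≥0∞ → ℝ≥0∞}
    {A K : ℝ≥0} (hφ : IsSobolevGrowth p ν φ A K) (hp : 1 ≤ p) :
    ∃ C : ℝ≥0, ∀ u : Rd d → ℝ, MemNonlocal p ν u → ∀ k : ℝ≥0, 0 < k →
      C * nonlocalNorm p ν u ≤ k → modular φ u k ≤ 1 ∧ modular (fun t => t ^ p) u k ≤ 1 := by
  have hp0 : 0 < p := by linarith
  have hK : K ≠ 0 := hφ.pos.ne'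
  -- The entry 1 serves the L^p-modular, the other one the energy condition of `modular_le_one`.
  refine ⟨max 1 ((A ^ 2 / K) ^ (1 / p)), fun u hu k hk hC => ?_⟩
  have hk0 : (k : ℝ≥0∞) ≠ 0 := by exact_mod_cast hk.ne'
  have h1 : nonlocalNorm p ν u ^ p ≤ (k : ℝ≥0∞) ^ p := by
    refine ENNReal.rpow_le_rpow (le_trans ?_ hC) hp0.le
    refine le_mul_of_one_le_left zero_le ?_
    exact_mod_cast le_max_left _ _
  have h2 : ((A ^ 2 / K : ℝ≥0) : ℝ≥0∞) * nonlocalNorm p ν u ^ p ≤ (k : ℝ≥0∞) ^ p := by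
    have : (((A ^ 2 / K) ^ (1 / p) : ℝ≥0) : ℝ≥0∞) * nonlocalNorm p ν u ≤ k := by
      refine le_trans ?_ hC
      gcongr
      exact_mod_cast le_max_right _ _
    have := ENNReal.rpow_le_rpow this hp0.le
    rwa [ENNReal.mul_rpow_of_nonneg _ _ hp0.le, ENNReal.coe_rpow_of_nonneg _ (by positivity),
      ← ENNReal.rpow_mul, one_div, inv_mul_cancel₀ hp0.ne', ENNReal.rpow_one] at this
  rw [nonlocalNorm_rpow hp] at h1 h2
  refine ⟨hφ.modular_le_one hp hu.1 hk ?_, ?_⟩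
  · calc (A : ℝ≥0∞) ^ 2 * energy p ν u
        = K * (((A ^ 2 / K : ℝ≥0) : ℝ≥0∞) * energy p ν u) := by
          rw [← mul_assoc, ← ENNReal.coe_mul, mul_div_cancel₀ _ hK, ENNReal.coe_pow]
      _ ≤ K * (((A ^ 2 / K : ℝ≥0) : ℝ≥0∞) * ((∫⁻ x, ‖u x‖ₑ ^ p) + energy p ν u)) := by
          gcongr
          exact le_add_self
      _ ≤ K * (k : ℝ≥0∞) ^ p := by gcongr
  · have hkp : (k : ℝ≥0∞) ^ p ≠ 0 := (ENNReal.rpow_pos (pos_iff_ne_zero.2 hk0) (by simp)).ne'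
    have hkp' : (k : ℝ≥0∞) ^ p ≠ ∞ := ENNReal.rpow_ne_top_of_nonneg hp0.le (by simp)
    simp only [modular, ENNReal.div_rpow_of_nonneg _ _ hp0.le]
    simp only [div_eq_mul_inv]
    rw [lintegral_mul_const' _ _ (ENNReal.inv_ne_top.2 hkp), ← div_eq_mul_inv]
    exact ENNReal.div_le_of_le_mul (by simpa using le_self_add.trans h1)

/-! ### Properties of the critical function -/

theorem IsYoungFunction.mul_le {ψ : ℝ≥0∞ → ℝ≥0∞} (hψ : IsYoungFunction ψ) {a : ℝ≥0} (ha : a ≤ 1)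
    (t : ℝ≥0∞) : ψ (a * t) ≤ a * ψ t := by
  have h := hψ.1.2 (Set.mem_univ t) (Set.mem_univ 0) (zero_le : 0 ≤ a) (zero_le : 0 ≤ 1 - a)
    (add_tsub_cancel_of_le ha)
  simpa [hψ.2, ENNReal.smul_def] using h

section critical

variable {d : ℕ} {p : ℝ} {ν : Rd d → ℝ≥0∞}

theorem wFun_zero (hp : 1 ≤ p) : wFun p ν 0 = 0 := by
  have : 0 < p⁻¹ := by positivity
  simp [wFun, this]

/-- Surjectivity makes `invFun` a true right inverse. Evaluating w at 1/φ(t) in this way yields all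
the later properties of φ, including its values at 0 and ∞. -/
theorem wFun_invFun (hw : Function.Bijective (wFun p ν)) (t : ℝ≥0∞) :
    wFun p ν (criticalFunction p ν t)⁻¹ = t⁻¹ := by
  rw [criticalFunction, inv_inv]
  exact Function.rightInverse_invFun hw.2 _

theorem criticalFunction_zero (hw : Function.Bijective (wFun p ν)) :
    criticalFunction p ν 0 = 0 := by
  have h : wFun p ν (criticalFunction p ν 0)⁻¹ = wFun p ν ∞ := by
    rw [wFun_invFun hw]; simp [wFun]
  simpa using hw.1 h

theorem criticalFunction_top (hp : 1 ≤ p) (hw : Function.Bijective (wFun p ν)) :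
    criticalFunction p ν ∞ = ∞ := by
  have h : wFun p ν (criticalFunction p ν ∞)⁻¹ = wFun p ν 0 := by
    rw [wFun_invFun hw, wFun_zero hp]; simp
  simpa using hw.1 h

theorem criticalFunction_ne_top (hp : 1 ≤ p) (hw : Function.Bijective (wFun p ν)) {t : ℝ≥0∞}
    (ht : t ≠ ∞) : criticalFunction p ν t ≠ ∞ := by
  intro h
  have h2 := wFun_invFun hw t
  rw [h, ENNReal.inv_top, wFun_zero hp] at h2
  exact ht (by simpa using h2.symm)

theorem criticalFunction_ne_zero (hw : Function.Bijective (wFun p ν)) {t : ℝ≥0∞}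
    (ht : t ≠ 0) : criticalFunction p ν t ≠ 0 := by
  intro h
  have h2 := wFun_invFun hw t
  rw [h] at h2
  simp [wFun] at h2
  exact ht (by simpa using h2.symm)

/-- This is w(1/φ(t)) = 1/t raised to the power p. It turns the bathtub bound into the condition
`lower` with K = 1. -/
theorem criticalFunction_eq_rpow_mul_sharp (hp : 1 ≤ p) (hw : Function.Bijective (wFun p ν))
    {t : ℝ≥0∞} (ht0 : t ≠ 0) (ht : t ≠ ∞) :
    criticalFunction p ν t = t ^ p * sharp ν (criticalFunction p ν t)⁻¹ := by
  have hp0 : 0 < p := by linarith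
  set r := criticalFunction p ν t with hr
  have hr0 : r ≠ 0 := criticalFunction_ne_zero hw ht0
  have hr1 : r ≠ ∞ := criticalFunction_ne_top hp hw ht
  have h := wFun_invFun hw t
  rw [← hr, wFun, if_neg (by simpa using hr0)] at h
  have h2 : r⁻¹ * sharp ν r⁻¹ = (t ^ p)⁻¹ := by
    rw [← ENNReal.inv_rpow, ← h, ← ENNReal.rpow_mul, one_div, inv_mul_cancel₀ hp0.ne',
      ENNReal.rpow_one]
  have htp0 : t ^ p ≠ 0 := (ENNReal.rpow_pos (pos_iff_ne_zero.2 ht0) ht).ne'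
  have htp1 : t ^ p ≠ ∞ := ENNReal.rpow_ne_top_of_nonneg hp0.le ht
  calc r = r * (t ^ p * (t ^ p)⁻¹) := by rw [ENNReal.mul_inv_cancel htp0 htp1, mul_one]
    _ = (r * r⁻¹) * (t ^ p * sharp ν r⁻¹) := by rw [← h2]; ring
    _ = _ := by rw [ENNReal.mul_inv_cancel hr0 hr1, one_mul]

/-- Convexity of τ ↦ φ(τ^{1/p}) between 0 and τ = t^p, with weight a^p. -/
theorem criticalFunction_mul_le (hp : 1 ≤ p)
    (hφ : IsYoungFunction (fun t => criticalFunction p ν (t ^ (1 / p)))) {a : ℝ≥0∞} (ha : a ≤ 1)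
    (t : ℝ≥0∞) : criticalFunction p ν (a * t) ≤ a ^ p * criticalFunction p ν t := by
  have hp0 : 0 < p := by linarith
  lift a to ℝ≥0 using ne_top_of_le_ne_top ENNReal.one_ne_top ha
  have h := hφ.mul_le (a := a ^ p) (NNReal.rpow_le_one (by exact_mod_cast ha) hp0.le) (t ^ p)
  have e : ∀ s : ℝ≥0∞, (s ^ p) ^ (1 / p) = s := fun s => by
    rw [← ENNReal.rpow_mul, mul_one_div_cancel hp0.ne', ENNReal.rpow_one]
  simpa only [ENNReal.coe_rpow_of_nonneg _ hp0.le, ← ENNReal.mul_rpow_of_nonneg _ _ hp0.le, e]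
    using h

theorem isSobolevGrowth_criticalFunction (hd : 1 ≤ d) (hp : 1 ≤ p) (hν : Measurable ν)
    (hw : Function.Bijective (wFun p ν))
    (hφ : IsYoungFunction (fun t => criticalFunction p ν (t ^ (1 / p))))
    (hθ : ∃ θ : ℝ≥0, 0 < θ ∧ ∀ s t : ℝ≥0∞, s ≤ t → 0 < t → t < ∞ →
        criticalFunction p ν (θ * (s / t)) ≤ criticalFunction p ν s / criticalFunction p ν t) :
    ∃ A : ℝ≥0, IsSobolevGrowth p ν (criticalFunction p ν) A 1 := by
  have hp0 : 0 < p := by linarith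
  obtain ⟨θ, hθ0, hθ⟩ := hθ
  have hθ0' : (θ : ℝ≥0∞) ≠ 0 := by exact_mod_cast hθ0.ne'
  -- The hypothesis `hθ` with s = t/2 reads κ φ(t) ≤ φ(t/2), so 1/κ is a doubling constant.
  set κ := criticalFunction p ν (θ * 2⁻¹) with hκ
  have hκ0 : κ ≠ 0 := criticalFunction_ne_zero hw (mul_ne_zero hθ0' (by simp))
  have hκ1 : κ ≠ ∞ := criticalFunction_ne_top hp hw (by finiteness)
  refine ⟨κ⁻¹.toNNReal, ?_, criticalFunction_zero hw,
    fun t ht => (criticalFunction_ne_top hp hw ht.ne).lt_top, ?_,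
    fun a t ha _ => criticalFunction_mul_le hp hφ ha t, one_pos, ?_⟩
  · intro s t hst
    rcases eq_or_ne t ∞ with rfl | ht
    · rw [criticalFunction_top hp hw]; exact le_top
    rcases eq_or_ne t 0 with rfl | ht0
    · rw [nonpos_iff_eq_zero.1 hst]
    have ha : s / t ≤ 1 := ENNReal.div_le_of_le_mul (by simpa using hst)
    have h := criticalFunction_mul_le hp hφ ha t
    rw [ENNReal.div_mul_cancel ht0 ht] at h
    exact h.trans (mul_le_of_le_one_left zero_le (ENNReal.rpow_le_one ha hp0.le))
  · intro t ht
    rw [ENNReal.coe_toNNReal (by simpa using hκ0)]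
    rcases eq_or_ne t 0 with rfl | ht0
    · simp [criticalFunction_zero hw]
    have h := hθ (t / 2) t ENNReal.half_le_self (pos_iff_ne_zero.2 ht0) ht
    have e : t / 2 / t = 2⁻¹ := by
      rw [div_eq_mul_inv, div_eq_mul_inv, mul_comm t, mul_assoc, ENNReal.mul_inv_cancel ht0 ht.ne,
        mul_one]
    rw [e, ← hκ, ENNReal.le_div_iff_mul_le (Or.inl (criticalFunction_ne_zero hw ht0))
      (Or.inl (criticalFunction_ne_top hp hw ht.ne))] at h
    rw [mul_comm, ← div_eq_mul_inv, ENNReal.le_div_iff_mul_le (Or.inl hκ0) (Or.inl hκ1), mul_comm]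
    exact h
  · intro x E t hE ht0 ht hEt
    obtain ⟨E', hE', hvol, hint⟩ := exists_reflected_set hν hE x
    rw [hint, ENNReal.coe_one, one_mul]
    nth_rewrite 1 [criticalFunction_eq_rpow_mul_sharp hp hw ht0.ne' ht.ne]
    gcongr
    refine sharp_le_setLIntegral_compl hd hν hE' ?_ (hvol ▸ hEt)
    simpa using criticalFunction_ne_zero hw ht0.ne'

end critical

/-! ### From modular bounds to embeddings -/

section embeddings

variable {d : ℕ} {p : ℝ} {ν : Rd d → ℝ≥0∞} {φ ψ : ℝ≥0∞ → ℝ≥0∞}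

/-- Replacing the maximum by a sum costs a factor 2 in the modular; convexity of ψ recovers it when
k is doubled. -/
theorem modular_div_le (hψ : IsYoungFunction ψ)
    {c : ℝ≥0} (hc : ∀ t : ℝ≥0∞, 0 < t → ψ (c * t) ≤ max (t ^ p) (φ t)) (hc0 : 0 < c)
    {u : Rd d → ℝ} (hu : AEStronglyMeasurable u volume) {k : ℝ≥0} (hk : 0 < k)
    (h1 : modular φ u k ≤ 1) (h2 : modular (fun t => t ^ p) u k ≤ 1) :
    modular ψ u (2 / c * k) ≤ 1 := by
  have hψc : ∀ t, ψ (c * t) ≤ t ^ p + φ t := by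
    intro t
    rcases eq_or_ne t 0 with rfl | ht
    · simp [hψ.2]
    · exact (hc t (pos_iff_ne_zero.2 ht)).trans (max_le le_self_add le_add_self)
  have hc0' : (c : ℝ≥0∞) ≠ 0 := by exact_mod_cast hc0.ne'
  have hk0 : (k : ℝ≥0∞) ≠ 0 := by exact_mod_cast hk.ne'
  calc modular ψ u (2 / c * k)
      ≤ ∫⁻ x, 2⁻¹ * ((‖u x‖ₑ / k) ^ p + φ (‖u x‖ₑ / k)) := by
        refine lintegral_mono fun x => ?_
        have e : ‖u x‖ₑ / (2 / c * k : ℝ≥0) = ((2⁻¹ : ℝ≥0) : ℝ≥0∞) * (c * (‖u x‖ₑ / k)) := by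
          rw [ENNReal.coe_mul, ENNReal.coe_div hc0.ne', ENNReal.coe_inv two_ne_zero]
          simp only [div_eq_mul_inv]
          have hc2 : 2 * (c : ℝ≥0∞)⁻¹ ≠ ∞ := ENNReal.mul_ne_top (by simp) (ENNReal.inv_ne_top.2 hc0')
          push_cast
          rw [ENNReal.mul_inv (Or.inr (by simp)) (Or.inl hc2),
            ENNReal.mul_inv (by simp) (by simp), inv_inv]
          ring
        dsimp only
        rw [e]
        refine (hψ.mul_le (by norm_num) _).trans ?_
        rw [ENNReal.coe_inv two_ne_zero, ENNReal.coe_ofNat]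
        gcongr
        exact hψc _
    _ = 2⁻¹ * (modular (fun t => t ^ p) u k + modular φ u k) := by
        rw [lintegral_const_mul' _ _ (by simp),
          lintegral_add_left' ((hu.enorm.div_const _).pow_const p)]
        rfl
    _ ≤ 2⁻¹ * (1 + 1) := by gcongr
    _ = 1 := by rw [one_add_one_eq_two]; exact ENNReal.inv_mul_cancel (by simp) (by simp)

theorem exists_pos_ge {a : ℝ≥0∞} (ha : a ≠ ∞) : ∃ k : ℝ≥0, 0 < k ∧ a ≤ k := by
  lift a to ℝ≥0 using ha
  exact ⟨a + 1, by positivity, by exact_mod_cast le_self_add⟩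

theorem nonlocalNorm_ne_top (hp : 1 ≤ p) {u : Rd d → ℝ} (hu : MemNonlocal p ν u) :
    nonlocalNorm p ν u ≠ ∞ := by
  have hp0 : 0 ≤ p := by linarith
  refine ENNReal.rpow_ne_top_of_nonneg (by positivity) (ENNReal.add_ne_top.2 ⟨?_, ?_⟩)
  · exact ENNReal.rpow_ne_top_of_nonneg hp0 hu.1.2.ne
  · exact ENNReal.rpow_ne_top_of_nonneg hp0 hu.2.ne

/-- The Luxemburg norm admits only k > 0, so k = C N is not allowed when it vanishes; k decreases to
C N instead. -/
theorem le_mul_of_forall_pos {a N : ℝ≥0∞} {B C : ℝ≥0} (hN : N ≠ ∞)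
    (h : ∀ k : ℝ≥0, 0 < k → C * N ≤ k → a ≤ B * k) : a ≤ (B * C : ℝ≥0) * N := by
  obtain ⟨M, hM⟩ : ∃ M : ℝ≥0, (M : ℝ≥0∞) = C * N := ⟨_, ENNReal.coe_toNNReal (by finiteness)⟩
  rw [ENNReal.coe_mul, mul_assoc, ← hM]
  refine ENNReal.le_of_forall_pos_le_add fun ε hε _ => ?_
  -- B + 1 in place of B covers B = 0.
  refine (h (M + ε / (B + 1)) (by positivity) (by rw [← hM]; exact_mod_cast le_self_add)).trans ?_
  rw [← ENNReal.coe_mul, ← ENNReal.coe_mul, ← ENNReal.coe_add, ENNReal.coe_le_coe, mul_add]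
  gcongr
  rw [← mul_div_assoc, div_le_iff₀ (by positivity), mul_comm]
  gcongr
  exact le_self_add

theorem IsSobolevGrowth.continuouslyEmbeds_orlicz {A K : ℝ≥0} (hφ : IsSobolevGrowth p ν φ A K)
    (hp : 1 ≤ p) (hψ : IsYoungFunction ψ) {c : ℝ≥0} (hc0 : 0 < c)
    (hc : ∀ t : ℝ≥0∞, 0 < t → ψ (c * t) ≤ max (t ^ p) (φ t)) :
    ContinuouslyEmbeds (MemNonlocal p ν) (nonlocalNorm p ν) (MemOrlicz ψ) (luxemburgNorm ψ) := by
  obtain ⟨C, hC⟩ := hφ.exists_const hp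
  have key : ∀ u, MemNonlocal p ν u → ∀ k : ℝ≥0, 0 < k → C * nonlocalNorm p ν u ≤ k →
      modular ψ u (2 / c * k) ≤ 1 := fun u hu k hk hCk =>
    modular_div_le hψ hc hc0 hu.1.1 hk (hC u hu k hk hCk).1
      (hC u hu k hk hCk).2
  refine ⟨fun u hu => ⟨hu.1.1, ?_⟩, 2 / c * C, fun u hu =>
    le_mul_of_forall_pos (nonlocalNorm_ne_top hp hu) fun k hk hCk => ?_⟩
  · obtain ⟨k, hk, hCk⟩ := exists_pos_ge
      (ENNReal.mul_ne_top (ENNReal.coe_ne_top (r := C)) (nonlocalNorm_ne_top hp hu))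
    exact ⟨2 / c * k, by positivity, (key u hu k hk hCk).trans_lt ENNReal.one_lt_top⟩
  · rw [← ENNReal.coe_mul]
    exact iInf₂_le _ ⟨by positivity, key u hu k hk hCk⟩

theorem modular_rpow_le_two {q r : ℝ} (hpq : p ≤ q) (hqr : q ≤ r)
    {u : Rd d → ℝ} (hu : AEStronglyMeasurable u volume) {k : ℝ≥0}
    (h1 : modular (fun t => t ^ r) u k ≤ 1) (h2 : modular (fun t => t ^ p) u k ≤ 1) :
    modular (fun t => t ^ q) u k ≤ 2 := by
  calc modular (fun t => t ^ q) u k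
      ≤ ∫⁻ x, ((‖u x‖ₑ / k) ^ p + (‖u x‖ₑ / k) ^ r) := by
        refine lintegral_mono fun x => ?_
        dsimp only
        rcases le_total (‖u x‖ₑ / k) 1 with h | h
        · exact (ENNReal.rpow_le_rpow_of_exponent_ge h hpq).trans le_self_add
        · exact (ENNReal.rpow_le_rpow_of_exponent_le h hqr).trans le_add_self
    _ = modular (fun t => t ^ p) u k + modular (fun t => t ^ r) u k :=
        lintegral_add_left' ((hu.enorm.div_const _).pow_const p) _
    _ ≤ 1 + 1 := by gcongr
    _ = 2 := one_add_one_eq_two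

theorem eLpNorm_le_two_mul_of_modular_le {q : ℝ} (hq : 1 ≤ q) {u : Rd d → ℝ} {k : ℝ≥0} (hk : 0 < k)
    (h : modular (fun t => t ^ q) u k ≤ 2) : eLpNorm u (ENNReal.ofReal q) volume ≤ 2 * k := by
  have hq0 : 0 < q := by linarith
  have hk0 : (k : ℝ≥0∞) ≠ 0 := by exact_mod_cast hk.ne'
  have hkp : (k : ℝ≥0∞) ^ q ≠ 0 := (ENNReal.rpow_pos (pos_iff_ne_zero.2 hk0) (by simp)).ne'
  have hkp' : (k : ℝ≥0∞) ^ q ≠ ∞ := ENNReal.rpow_ne_top_of_nonneg hq0.le (by simp)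
  rw [← ENNReal.rpow_le_rpow_iff hq0, eLpNorm_rpow_eq_lintegral hq,
    ENNReal.mul_rpow_of_nonneg _ _ hq0.le]
  simp only [modular, ENNReal.div_rpow_of_nonneg _ _ hq0.le] at h
  simp only [div_eq_mul_inv] at h
  rw [lintegral_mul_const' _ _ (ENNReal.inv_ne_top.2 hkp), ← div_eq_mul_inv,
    ENNReal.div_le_iff hkp hkp'] at h
  refine h.trans ?_
  gcongr
  -- The bound 2 ≤ 2^q, from q ≥ 1, lets the factor 2 of the modular enter the norm.
  nth_rewrite 1 [← ENNReal.rpow_one 2]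
  exact ENNReal.rpow_le_rpow_of_exponent_le (by norm_num) hq

theorem IsSobolevGrowth.continuouslyEmbeds_eLpNorm {A K : ℝ≥0} {q r : ℝ}
    (hφ : IsSobolevGrowth p ν (fun t => t ^ r) A K) (hp : 1 ≤ p) (hpq : p ≤ q) (hqr : q ≤ r) :
    ContinuouslyEmbeds (MemNonlocal p ν) (nonlocalNorm p ν)
      (fun u => MemLp u (ENNReal.ofReal q) volume)
      (fun u => eLpNorm u (ENNReal.ofReal q) volume) := by
  obtain ⟨C, hC⟩ := hφ.exists_const hp
  have key : ∀ u, MemNonlocal p ν u → ∀ k : ℝ≥0, 0 < k → C * nonlocalNorm p ν u ≤ k →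
      eLpNorm u (ENNReal.ofReal q) volume ≤ (2 : ℝ≥0) * k := fun u hu k hk hCk =>
    eLpNorm_le_two_mul_of_modular_le (hp.trans hpq) hk
      (modular_rpow_le_two hpq hqr hu.1.1 (hC u hu k hk hCk).1
        (hC u hu k hk hCk).2)
  refine ⟨fun u hu => ⟨hu.1.1, ?_⟩, 2 * C, fun u hu =>
    le_mul_of_forall_pos (nonlocalNorm_ne_top hp hu) (key u hu)⟩
  obtain ⟨k, hk, hCk⟩ := exists_pos_ge
    (ENNReal.mul_ne_top (ENNReal.coe_ne_top (r := C)) (nonlocalNorm_ne_top hp hu))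
  exact (key u hu k hk hCk).trans_lt (by finiteness)

end embeddings

/-! ### The fractional kernel -/

section fractional

variable {d : ℕ} {s p : ℝ}

/-- Lower bound for the integral of the fractional kernel off a set of measure at most `r`. -/
theorem le_setLIntegral_compl_fractionalKernel (hd : 1 ≤ d) (hsp : 0 ≤ s * p) {E : Set (Rd d)}
    (hE : MeasurableSet E) {r : ℝ≥0∞} (hr : r ≠ ∞) (hEr : volume E ≤ r) :
    r * ballRadius d (2 * r) ^ (-((d : ℝ) + s * p)) ≤ ∫⁻ h in Eᶜ, fractionalKernel d s p h := by
  have hd0 : (0 : ℝ) < d := by exact_mod_cast hd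
  -- The ball of measure 2r keeps measure at least r after removing E, and the kernel is at least
  -- R^{-d-sp} on it.
  set R := ballRadius d (2 * r) with hR
  have hc1 : unitBallVolume d ≠ 0 := (Metric.measure_ball_pos volume _ one_pos).ne'
  have hRtop : R ≠ ∞ := by
    refine ENNReal.rpow_ne_top_of_nonneg (by positivity) ?_
    exact ENNReal.div_ne_top (by finiteness) hc1
  set B : Set (Rd d) := Metric.ball 0 R.toReal with hB
  have hBvol : volume B = 2 * r := by
    have : Nonempty (Fin d) := ⟨⟨0, hd⟩⟩
    rw [hB, Measure.addHaar_ball _ _ ENNReal.toReal_nonneg, finrank_euclideanSpace_fin,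
      ENNReal.ofReal_pow ENNReal.toReal_nonneg, ENNReal.ofReal_toReal hRtop, mul_comm]
    exact unitBallVolume_mul_ballRadius_pow hd _
  have hBE : r ≤ volume (B \ E) := by
    have h : volume B ≤ volume (B \ E) + r :=
      (measure_le_inter_add_sdiff volume B E).trans
        (by rw [add_comm]; gcongr; exact (measure_mono Set.inter_subset_right).trans hEr)
    rw [hBvol, two_mul] at h
    exact (ENNReal.add_le_add_iff_right hr).1 h
  calc r * R ^ (-((d : ℝ) + s * p)) ≤ R ^ (-((d : ℝ) + s * p)) * volume (B \ E) := by
        rw [mul_comm]; gcongr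
    _ = ∫⁻ _ in B \ E, R ^ (-((d : ℝ) + s * p)) := (setLIntegral_const _ _).symm
    _ ≤ ∫⁻ h in B \ E, fractionalKernel d s p h := by
        refine setLIntegral_mono' (Metric.isOpen_ball.measurableSet.diff hE) fun h hh => ?_
        rw [fractionalKernel, ENNReal.rpow_neg, ENNReal.rpow_neg, ENNReal.inv_le_inv]
        refine ENNReal.rpow_le_rpow ?_ (by positivity)
        have := mem_ball_zero_iff.1 hh.1
        rw [← ofReal_norm, ← ENNReal.ofReal_toReal hRtop]
        exact ENNReal.ofReal_le_ofReal this.le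
    _ ≤ ∫⁻ h in Eᶜ, fractionalKernel d s p h := lintegral_mono_set fun h hh => hh.2

theorem measurable_fractionalKernel : Measurable (fractionalKernel d s p) :=
  measurable_enorm.pow_const _

theorem isSobolevGrowth_fractionalKernel (hd : 1 ≤ d) (hp : 1 ≤ p) (hs : 0 < s)
    (hps : 0 < 1 / p - s / d) :
    ∃ A K : ℝ≥0, IsSobolevGrowth p (fractionalKernel d s p)
      (fun t => t ^ (1 / p - s / d)⁻¹) A K := by
  have hp0 : 0 < p := by linarith
  have hd0 : (0 : ℝ) < d := by exact_mod_cast hd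
  set q := (1 / p - s / d)⁻¹ with hq
  have hq0 : 0 < q := inv_pos.2 hps
  have hpq : p ≤ q := by
    rw [hq, le_inv_comm₀ hp0 hps, ← one_div]
    linarith [div_pos hs hd0]
  -- With r = t^{-q} this gives R^{-d-sp} = K t^{2q-p}, so that t^p · r · R^{-d-sp} is exactly K
  -- t^q.
  have hqs : q * (s * p / d) = q - p := by
    have h1 : q * (1 / p - s / d) = 1 := inv_mul_cancel₀ hps.ne'
    have : q * (1 / p - s / d) * p = p := by rw [h1, one_mul]
    have e : q * (1 / p - s / d) * p = q - q * (s * p / d) := by field_simp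
    linarith
  have hc0 : unitBallVolume d ≠ 0 := (Metric.measure_ball_pos volume _ one_pos).ne'
  have hc1 : unitBallVolume d ≠ ∞ := measure_ball_lt_top.ne
  set b : ℝ := -((d : ℝ) + s * p) with hb
  set K : ℝ≥0∞ := ((2 / unitBallVolume d) ^ (1 / (d : ℝ))) ^ b with hK
  have h2c0 : (2 / unitBallVolume d) ^ (1 / (d : ℝ)) ≠ 0 :=
    (ENNReal.rpow_pos (ENNReal.div_pos two_ne_zero hc1) (ENNReal.div_ne_top (by simp) hc0)).ne'
  have h2c1 : (2 / unitBallVolume d) ^ (1 / (d : ℝ)) ≠ ∞ :=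
    ENNReal.rpow_ne_top_of_nonneg (by positivity) (ENNReal.div_ne_top (by simp) hc0)
  have hK0 : K ≠ 0 := (ENNReal.rpow_pos (pos_iff_ne_zero.2 h2c0) h2c1).ne'
  have hK1 : K ≠ ∞ := ENNReal.rpow_ne_top_of_ne_zero h2c0 h2c1
  refine ⟨2 ^ q, K.toNNReal, fun a t h => ENNReal.rpow_le_rpow h hq0.le,
    ENNReal.zero_rpow_of_pos hq0, fun t ht => ENNReal.rpow_lt_top_of_nonneg hq0.le ht.ne, ?_, ?_,
    ENNReal.toNNReal_pos hK0 hK1, ?_⟩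
  · intro t _
    rw [ENNReal.coe_rpow_of_nonneg _ hq0.le, ENNReal.coe_ofNat,
      ← ENNReal.mul_rpow_of_nonneg _ _ hq0.le, ENNReal.mul_div_cancel two_ne_zero (by simp)]
  · intro a t ha _
    rw [ENNReal.mul_rpow_of_nonneg _ _ hq0.le]
    gcongr ?_ * _
    exact ENNReal.rpow_le_rpow_of_exponent_ge ha hpq
  · intro x E t hE ht0 ht hEt
    obtain ⟨E', hE', hvol, hint⟩ := exists_reflected_set measurable_fractionalKernel hE x
    have htq0 : t ^ q ≠ 0 := (ENNReal.rpow_pos ht0 ht.ne).ne'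
    have htq1 : t ^ q ≠ ∞ := ENNReal.rpow_ne_top_of_nonneg hq0.le ht.ne
    have h := le_setLIntegral_compl_fractionalKernel hd (mul_pos hs hp0).le hE'
      (ENNReal.inv_ne_top.2 htq0) (hvol ▸ hEt)
    rw [hint, ENNReal.coe_toNNReal hK1]
    refine le_trans (le_of_eq ?_) (mul_le_mul_right h _)
    have e : ballRadius d (2 * (t ^ q)⁻¹) ^ b = K * t ^ (q + (q - p)) := by
      have : 2 * (t ^ q)⁻¹ / unitBallVolume d = 2 / unitBallVolume d * t ^ (-q) := by
        rw [ENNReal.rpow_neg, div_eq_mul_inv, div_eq_mul_inv]; ring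
      rw [ballRadius, this, ENNReal.mul_rpow_of_nonneg _ _ (by positivity),
        ENNReal.mul_rpow_of_ne_top h2c1 ?_, ← hK, ← ENNReal.rpow_mul, ← ENNReal.rpow_mul]
      · congr 2
        rw [← hqs, hb]
        field_simp
      · refine ENNReal.rpow_ne_top_of_nonneg (by positivity) ?_
        exact ENNReal.rpow_ne_top_of_ne_zero ht0.ne' ht.ne
    rw [e, ← ENNReal.rpow_neg]
    calc K * t ^ q = K * t ^ (p + -q + (q + (q - p))) := by ring_nf
      _ = _ := by
        rw [ENNReal.rpow_add _ _ ht0.ne' ht.ne, ENNReal.rpow_add _ _ ht0.ne' ht.ne]; ring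

end fractional

/-! ### Translation estimates for weakly differentiable functions -/

section translation

variable {d : ℕ} {p : ℝ}

/-- The uniform probability measure on the unit interval. -/
noncomputable abbrev unitIntervalMeasure : Measure ℝ := volume.restrict (Set.Ioc 0 1)

instance : IsProbabilityMeasure unitIntervalMeasure := ⟨by simp [unitIntervalMeasure]⟩

/-- Provides the domination for Fubini: for 0 < t ≤ 1 the integrand vanishes outside a ball enlarged
by ‖h‖, on which u is integrable. -/
theorem integrable_mul_comp_add_smul {u ζ : Rd d → ℝ} (hu : LocallyIntegrable u)
    (hζ : Continuous ζ) (hζc : HasCompactSupport ζ) (h : Rd d) :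
    Integrable (fun z : ℝ × Rd d => u z.2 * ζ (z.2 + z.1 • h))
      (unitIntervalMeasure.prod volume) := by
  obtain ⟨M, hM⟩ := hζ.bounded_above_of_compact_support hζc
  obtain ⟨R, hR⟩ := hζc.isCompact.isBounded.subset_closedBall 0
  set B : Set (Rd d) := Metric.closedBall 0 (R + ‖h‖) with hB
  have hdom : Integrable (B.indicator fun x => M * ‖u x‖) volume :=
    (integrable_indicator_iff measurableSet_closedBall).2
      ((hu.integrableOn_isCompact (isCompact_closedBall _ _)).norm.const_mul M)
  refine (hdom.comp_snd unitIntervalMeasure).mono' ?_ ?_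
  · exact hu.aestronglyMeasurable.comp_snd.mul
      (hζ.comp (by fun_prop : Continuous fun z : ℝ × Rd d => z.2 + z.1 • h)).aestronglyMeasurable
  · have hae : ∀ᵐ z : ℝ × Rd d ∂(unitIntervalMeasure.prod volume), z.1 ∈ Set.Ioc (0 : ℝ) 1 :=
      Measure.quasiMeasurePreserving_fst.ae (ae_restrict_mem measurableSet_Ioc)
    filter_upwards [hae] with z hz
    by_cases hzB : z.2 ∈ B
    · rw [Set.indicator_of_mem hzB, norm_mul, mul_comm]
      gcongr
      exact hM _
    · rw [Set.indicator_of_notMem hzB]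
      have : ζ (z.2 + z.1 • h) = 0 := by
        by_contra hne
        have hmem := hR (subset_tsupport _ hne)
        rw [mem_closedBall_zero_iff] at hmem
        refine hzB (mem_closedBall_zero_iff.2 ?_)
        calc ‖z.2‖ = ‖(z.2 + z.1 • h) - z.1 • h‖ := by rw [add_sub_cancel_right]
          _ ≤ ‖z.2 + z.1 • h‖ + ‖z.1 • h‖ := norm_sub_le _ _
          _ ≤ R + 1 * ‖h‖ := by
            rw [norm_smul]
            gcongr
            rw [Real.norm_eq_abs, abs_of_pos hz.1]
            exact hz.2
          _ = R + ‖h‖ := by rw [one_mul]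
      simp [this]

/-- Moves the translation from the test function to the other factor, keeping joint integrability.
-/
theorem measurePreserving_shear (h : Rd d) :
    MeasurePreserving (fun z : ℝ × Rd d => (z.1, z.2 - z.1 • h))
      (unitIntervalMeasure.prod volume) (unitIntervalMeasure.prod volume) := by
  refine (MeasurePreserving.id unitIntervalMeasure).skew_product
    (g := fun t x => x - t • h) (by fun_prop) (Filter.Eventually.of_forall fun t => ?_)
  exact (measurePreserving_sub_right volume (t • h)).map_eq

/-- The average of `f` along the segment from `x - h` to `x`. -/
noncomputable def segmentAverage (f : Rd d → ℝ) (h x : Rd d) : ℝ :=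
  ∫ t, f (x - t • h) ∂unitIntervalMeasure

/-- Jensen's inequality on the unit interval, in the form of monotonicity of L^p norms for a
probability measure, then Tonelli and translation invariance. -/
theorem lintegral_segmentAverage_rpow_le (hp : 1 ≤ p) {f : Rd d → ℝ} (hf : StronglyMeasurable f)
    (h : Rd d) : ∫⁻ x, ‖segmentAverage f h x‖ₑ ^ p ≤ ∫⁻ x, ‖f x‖ₑ ^ p := by
  have hp0 : 0 < p := by linarith
  have hm : Measurable f := hf.measurable
  calc ∫⁻ x, ‖segmentAverage f h x‖ₑ ^ p
      ≤ ∫⁻ x, ∫⁻ t, ‖f (x - t • h)‖ₑ ^ p ∂unitIntervalMeasure := by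
        refine lintegral_mono fun x => ?_
        have hsm : AEStronglyMeasurable (fun t : ℝ => f (x - t • h)) unitIntervalMeasure :=
          (hf.comp_measurable (by fun_prop)).aestronglyMeasurable
        have h1 := eLpNorm_le_eLpNorm_of_exponent_le
          (p := 1) (q := ENNReal.ofReal p) (by simpa using hp) hsm
        rw [eLpNorm_one_eq_lintegral_enorm] at h1
        have h2 := ENNReal.rpow_le_rpow ((enorm_integral_le_lintegral_enorm _).trans h1) hp0.le
        rwa [eLpNorm_rpow_eq_lintegral hp] at h2
    _ = ∫⁻ t, (∫⁻ x, ‖f (x - t • h)‖ₑ ^ p) ∂unitIntervalMeasure := by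
        refine lintegral_lintegral_swap (Measurable.aemeasurable ?_)
        exact (hm.comp
          (by fun_prop : Measurable fun z : Rd d × ℝ => z.1 - z.2 • h)).enorm.pow_const p
    _ = ∫⁻ _, (∫⁻ x, ‖f x‖ₑ ^ p) ∂unitIntervalMeasure := by
        refine lintegral_congr fun t => ?_
        exact lintegral_sub_right_eq_self (fun x => ‖f x‖ₑ ^ p) (t • h)
    _ = ∫⁻ x, ‖f x‖ₑ ^ p := by simp

theorem stronglyMeasurable_segmentAverage {f : Rd d → ℝ} (hf : StronglyMeasurable f) (h : Rd d) :
    StronglyMeasurable (segmentAverage f h) :=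
  StronglyMeasurable.integral_prod_right'
    (f := fun z : Rd d × ℝ => f (z.1 - z.2 • h)) (hf.comp_measurable (by fun_prop))

theorem integral_fderiv_segment {η : Rd d → ℝ} (hη : ContDiff ℝ ((⊤ : ℕ∞) : WithTop ℕ∞) η)
    (h x : Rd d) :
    ∫ t, fderiv ℝ η (x + t • h) h ∂unitIntervalMeasure = η (x + h) - η x := by
  rw [← intervalIntegral.integral_of_le zero_le_one]
  have hd : ∀ t : ℝ, HasDerivAt (fun t : ℝ => η (x + t • h)) (fderiv ℝ η (x + t • h) h) t := by
    intro t
    have h1 : HasDerivAt (fun t : ℝ => x + t • h) h t := by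
      simpa using ((hasDerivAt_id t).smul_const h).const_add x
    exact ((hη.differentiable (by simp)) _).hasFDerivAt.comp_hasDerivAt t h1
  rw [intervalIntegral.integral_eq_sub_of_hasDerivAt (fun t _ => hd t)]
  · simp
  · refine Continuous.intervalIntegrable ?_ _ _
    exact ((hη.continuous_fderiv (by simp)).comp (by fun_prop)).clm_apply continuous_const

/-- If `f` is the weak derivative of `u` in direction `h`, then `u x - u (x - h)` is the average of
`f` over the segment from `x - h` to `x`. -/
theorem ae_sub_eq_segmentAverage (hp : 1 ≤ p) {u f : Rd d → ℝ} {h : Rd d}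
    (hu : MemLp u (ENNReal.ofReal p)) (hf : MemLp f (ENNReal.ofReal p))
    (hfm : StronglyMeasurable f)
    (hw : ∀ η : Rd d → ℝ, ContDiff ℝ ((⊤ : ℕ∞) : WithTop ℕ∞) η → HasCompactSupport η →
      ∫ x, u x * fderiv ℝ η x h = - ∫ x, f x * η x) :
    ∀ᵐ x, u x - u (x - h) = segmentAverage f h x := by
  have hp0 : 0 < p := by linarith
  have hp1 : 1 ≤ ENNReal.ofReal p := by simpa using hp
  have hul := hu.locallyIntegrable hp1
  have hfl := hf.locallyIntegrable hp1
  have huh : MemLp (fun x => u (x - h)) (ENNReal.ofReal p) :=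
    hu.comp_measurePreserving (measurePreserving_sub_right volume h)
  have hG : MemLp (segmentAverage f h) (ENNReal.ofReal p) := by
    refine ⟨(stronglyMeasurable_segmentAverage hfm h).aestronglyMeasurable, ?_⟩
    rw [← ENNReal.rpow_lt_top_iff_of_pos hp0, eLpNorm_rpow_eq_lintegral hp]
    refine (lintegral_segmentAverage_rpow_le hp hfm h).trans_lt ?_
    rw [← eLpNorm_rpow_eq_lintegral hp]
    exact ENNReal.rpow_lt_top_of_nonneg hp0.le hf.2.ne
  refine ae_eq_of_integral_contDiff_smul_eq (hul.sub (huh.locallyIntegrable hp1))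
    (hG.locallyIntegrable hp1) fun η hη hηc => ?_
  have hηc' : HasCompactSupport fun x => fderiv ℝ η x h := hηc.fderiv_apply ℝ h
  have hηd : Continuous fun x => fderiv ℝ η x h :=
    (hη.continuous_fderiv (by simp)).clm_apply continuous_const
  have hI1 := integrable_mul_comp_add_smul hul hηd hηc' h
  have hI2 : Integrable (fun z : ℝ × Rd d => f (z.2 - z.1 • h) * η z.2)
      (unitIntervalMeasure.prod volume) := by
    have := (measurePreserving_shear h).integrable_comp_of_integrable
      (integrable_mul_comp_add_smul hfl hη.continuous hηc h)
    simpa [Function.comp_def] using this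
  have hshift : ∀ a : Rd d, ContDiff ℝ ((⊤ : ℕ∞) : WithTop ℕ∞) (fun x => η (x + a)) ∧
      HasCompactSupport fun x => η (x + a) := fun a =>
    ⟨hη.comp (by fun_prop), hηc.comp_homeomorph (Homeomorph.addRight a)⟩
  -- Fubini and the weak derivative against the shifted test functions η(· + th) turn the average of
  -- f into the average of the derivatives of η, which integrates to η(x + h) - η(x). No smooth
  -- approximation of u is needed.
  have hright : ∫ x, η x • segmentAverage f h x =
      - ∫ x, u x * (η (x + h) - η x) := by
    calc ∫ x, η x • segmentAverage f h x
        = ∫ x, ∫ t, f (x - t • h) * η x ∂unitIntervalMeasure := by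
          refine integral_congr_ae (Filter.Eventually.of_forall fun x => ?_)
          simp only [segmentAverage, smul_eq_mul]
          rw [integral_mul_const, mul_comm]
      _ = ∫ t, (∫ x, f (x - t • h) * η x) ∂unitIntervalMeasure :=
          (integral_integral_swap hI2).symm
      _ = ∫ t, (- ∫ x, u x * fderiv ℝ η (x + t • h) h) ∂unitIntervalMeasure := by
          refine integral_congr_ae (Filter.Eventually.of_forall fun t => ?_)
          have h1 := hw _ (hshift (t • h)).1 (hshift (t • h)).2
          simp only [fderiv_comp_add_right] at h1
          dsimp only
          rw [h1, neg_neg, ← integral_sub_right_eq_self (fun x => f x * η (x + t • h)) (t • h)]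
          simp
      _ = - ∫ x, ∫ t, u x * fderiv ℝ η (x + t • h) h ∂unitIntervalMeasure := by
          rw [integral_neg, integral_integral_swap hI1]
      _ = - ∫ x, u x * (η (x + h) - η x) := by
          congr 1
          refine integral_congr_ae (Filter.Eventually.of_forall fun x => ?_)
          dsimp only
          rw [integral_const_mul, integral_fderiv_segment hη]
  have hi : ∀ {v ζ : Rd d → ℝ}, LocallyIntegrable v → ContDiff ℝ ((⊤ : ℕ∞) : WithTop ℕ∞) ζ →
      HasCompactSupport ζ → Integrable fun x => v x * ζ x := fun hv hζ hζc =>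
    hv.integrable_smul_right_of_hasCompactSupport hζ.continuous hζc
  rw [hright]
  have hi1 := hi hul hη hηc
  have hi2 := hi hul (hshift h).1 (hshift h).2
  have hi3 := hi (huh.locallyIntegrable hp1) hη hηc
  have e1 : ∫ x, η x • (u - fun x => u (x - h)) x =
      (∫ x, u x * η x) - ∫ x, u (x - h) * η x := by
    rw [← integral_sub hi1 hi3]
    refine integral_congr_ae (Filter.Eventually.of_forall fun x => ?_)
    simp only [Pi.sub_apply, smul_eq_mul]
    ring
  have e2 : ∫ x, u (x - h) * η x = ∫ x, u x * η (x + h) := by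
    rw [← integral_sub_right_eq_self (fun x => u x * η (x + h)) h]
    simp
  refine e1.trans ?_
  simp only [mul_sub]
  rw [integral_sub hi2 hi1, e2, neg_sub]

theorem lintegral_sub_translate_rpow_le (hp : 1 ≤ p) {u : Rd d → ℝ} {g : Rd d → Rd d}
    (hu : MemLp u (ENNReal.ofReal p)) (hg : MemLp g (ENNReal.ofReal p)) (hw : IsWeakGradient u g)
    (h : Rd d) : ∫⁻ x, ‖u x - u (x - h)‖ₑ ^ p ≤ ‖h‖ₑ ^ p * ∫⁻ x, ‖g x‖ₑ ^ p := by
  have hp0 : 0 < p := by linarith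
  have hp1 : 1 ≤ ENNReal.ofReal p := by simpa using hp
  -- Segment averages evaluate the gradient along lines, so a strongly measurable representative is
  -- taken.
  set g' := hg.1.mk g with hg'
  have hae : g =ᵐ[volume] g' := hg.1.ae_eq_mk
  have hg'm : StronglyMeasurable g' := hg.1.stronglyMeasurable_mk
  have hg'p : MemLp g' (ENNReal.ofReal p) := hg.ae_eq hae
  set f : Rd d → ℝ := fun x => ∑ i, h i * g' x i with hf
  have hfm : StronglyMeasurable f := by
    refine Finset.stronglyMeasurable_fun_sum _ fun i _ => ?_
    exact ((EuclideanSpace.proj i : Rd d →L[ℝ] ℝ).continuous.comp_stronglyMeasurable hg'm).const_mul (h i)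
  have hcoord : ∀ i, MemLp (fun x => g' x i) (ENNReal.ofReal p) := fun i =>
    (EuclideanSpace.proj i : Rd d →L[ℝ] ℝ).comp_memLp' hg'p
  have hfp : MemLp f (ENNReal.ofReal p) :=
    memLp_finsetSum _ fun i _ => (hcoord i).const_mul (h i)
  have hfle : ∀ x, ‖f x‖ₑ ≤ ‖h‖ₑ * ‖g' x‖ₑ := by
    intro x
    have e : f x = inner ℝ (g' x) h := by
      simp [hf, PiLp.inner_apply]
    rw [e, mul_comm, ← ofReal_norm, ← ofReal_norm, ← ofReal_norm,
      ← ENNReal.ofReal_mul (norm_nonneg _)]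
    exact ENNReal.ofReal_le_ofReal (norm_inner_le_norm _ _)
  have hwf : ∀ η : Rd d → ℝ, ContDiff ℝ ((⊤ : ℕ∞) : WithTop ℕ∞) η → HasCompactSupport η →
      ∫ x, u x * fderiv ℝ η x h = - ∫ x, f x * η x := by
    intro η hη hηc
    have hsum : h = ∑ i, h i • EuclideanSpace.single i (1 : ℝ) := by
      ext j
      simp [Finset.sum_apply, Pi.single_apply]
    have e1 : ∀ x, u x * fderiv ℝ η x h =
        ∑ i, h i * (u x * fderiv ℝ η x (EuclideanSpace.single i 1)) := by
      intro x
      conv_lhs => rw [hsum]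
      rw [map_sum, Finset.mul_sum]
      refine Finset.sum_congr rfl fun i _ => ?_
      rw [map_smul, smul_eq_mul]; ring
    have e2 : ∀ x, f x * η x = ∑ i, h i * (g' x i * η x) := by
      intro x
      rw [hf, Finset.sum_mul]
      exact Finset.sum_congr rfl fun i _ => by ring
    simp only [e1, e2]
    rw [integral_finsetSum, integral_finsetSum, ← Finset.sum_neg_distrib]
    · refine Finset.sum_congr rfl fun i _ => ?_
      rw [integral_const_mul, integral_const_mul, hw η hη hηc i, mul_neg]
      congr 2
      refine integral_congr_ae ?_
      filter_upwards [hae] with x hx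
      rw [hx]
    · intro i _
      exact (((hcoord i).locallyIntegrable hp1).integrable_smul_right_of_hasCompactSupport
        hη.continuous hηc).const_mul (h i)
    · intro i _
      exact ((hu.locallyIntegrable hp1).integrable_smul_right_of_hasCompactSupport
        ((hη.continuous_fderiv (by simp)).clm_apply continuous_const)
        (hηc.fderiv_apply ℝ _)).const_mul (h i)
  calc ∫⁻ x, ‖u x - u (x - h)‖ₑ ^ p = ∫⁻ x, ‖segmentAverage f h x‖ₑ ^ p := by
        refine lintegral_congr_ae ?_
        filter_upwards [ae_sub_eq_segmentAverage hp hu hfp hfm hwf] with x hx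
        rw [hx]
    _ ≤ ∫⁻ x, ‖f x‖ₑ ^ p := lintegral_segmentAverage_rpow_le hp hfm h
    _ ≤ ∫⁻ x, ‖h‖ₑ ^ p * ‖g' x‖ₑ ^ p := by
        refine lintegral_mono fun x => ?_
        rw [← ENNReal.mul_rpow_of_nonneg _ _ hp0.le]
        exact ENNReal.rpow_le_rpow (hfle x) hp0.le
    _ = ‖h‖ₑ ^ p * ∫⁻ x, ‖g x‖ₑ ^ p := by
        rw [lintegral_const_mul' _ _ (ENNReal.rpow_ne_top_of_nonneg hp0.le (by simp))]
        congr 1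
        refine lintegral_congr_ae ?_
        filter_upwards [hae] with x hx
        rw [hx]

theorem lintegral_sub_translate_rpow_le_two (hp : 1 ≤ p) {u : Rd d → ℝ} (hu : Measurable u)
    (h : Rd d) : ∫⁻ x, ‖u x - u (x - h)‖ₑ ^ p ≤ 2 ^ p * ∫⁻ x, ‖u x‖ₑ ^ p := by
  have hp0 : 0 < p := by linarith
  calc ∫⁻ x, ‖u x - u (x - h)‖ₑ ^ p
      ≤ ∫⁻ x, 2 ^ (p - 1) * (‖u x‖ₑ ^ p + ‖u (x - h)‖ₑ ^ p) := by
        refine lintegral_mono fun x => ?_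
        refine le_trans (ENNReal.rpow_le_rpow ?_ hp0.le)
          (ENNReal.rpow_add_le_mul_rpow_add_rpow _ _ hp)
        exact enorm_sub_le
    _ = 2 ^ (p - 1) * ((∫⁻ x, ‖u x‖ₑ ^ p) + ∫⁻ x, ‖u x‖ₑ ^ p) := by
        rw [lintegral_const_mul' _ _ (ENNReal.rpow_ne_top_of_nonneg (by linarith) (by simp)),
          lintegral_add_left (hu.enorm.pow_const p),
          lintegral_sub_right_eq_self (fun x => ‖u x‖ₑ ^ p) h]
    _ = 2 ^ p * ∫⁻ x, ‖u x‖ₑ ^ p := by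
        rw [← two_mul, ← mul_assoc]
        congr 1
        nth_rewrite 2 [← ENNReal.rpow_one 2]
        rw [← ENNReal.rpow_add _ _ two_ne_zero (by simp), sub_add_cancel]

/-! ### Embedding of W^{1,p} into W_ν^p -/

theorem IsWeakGradient.congr_left {u u' : Rd d → ℝ} {g : Rd d → Rd d} (h : u =ᵐ[volume] u')
    (hw : IsWeakGradient u g) : IsWeakGradient u' g := by
  intro η hη hηc i
  rw [← hw η hη hηc i]
  refine integral_congr_ae ?_
  filter_upwards [h] with x hx
  rw [hx]

/-- After the substitution h = x - y and Tonelli, each h is treated by whichever translation bound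
matches min(1, |h|^p): the trivial one for 1, the gradient one for |h|^p. -/
theorem energy_le_of_measurable (hp : 1 ≤ p) {ν : Rd d → ℝ≥0∞} (hν : Measurable ν) {u : Rd d → ℝ}
    {g : Rd d → Rd d} (hum : Measurable u) (hu : MemLp u (ENNReal.ofReal p))
    (hg : MemLp g (ENNReal.ofReal p)) (hw : IsWeakGradient u g) :
    energy p ν u ≤ 2 ^ p * (∫⁻ h, min 1 (‖h‖ₑ ^ p) * ν h) *
      ((∫⁻ x, ‖u x‖ₑ ^ p) + ∫⁻ x, ‖g x‖ₑ ^ p) := by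
  have hp0 : 0 < p := by linarith
  set S := (∫⁻ x, ‖u x‖ₑ ^ p) + ∫⁻ x, ‖g x‖ₑ ^ p with hS
  have h2 : (1 : ℝ≥0∞) ≤ 2 ^ p := ENNReal.one_le_rpow one_le_two hp0
  calc energy p ν u = ∫⁻ x, ∫⁻ h, ‖u x - u (x - h)‖ₑ ^ p * ν h := by
        refine lintegral_congr fun x => ?_
        rw [← lintegral_sub_left_eq_self _ x]
        simp
    _ = ∫⁻ h, ∫⁻ x, ‖u x - u (x - h)‖ₑ ^ p * ν h := by
        refine lintegral_lintegral_swap (Measurable.aemeasurable ?_)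
        refine Measurable.mul (Measurable.pow_const (Measurable.enorm ?_) p)
          (hν.comp measurable_snd)
        exact (hum.comp measurable_fst).sub (hum.comp (measurable_fst.sub measurable_snd))
    _ ≤ ∫⁻ h, 2 ^ p * S * (min 1 (‖h‖ₑ ^ p) * ν h) := by
        refine lintegral_mono fun h => ?_
        dsimp only
        have hm : Measurable fun x => ‖u x - u (x - h)‖ₑ ^ p :=
          (hum.sub (hum.comp (measurable_id.sub_const h))).enorm.pow_const p
        rw [lintegral_mul_const _ hm, ← mul_assoc]
        gcongr
        rcases min_choice 1 (‖h‖ₑ ^ p) with hm | hm <;> rw [hm]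
        · rw [mul_one]
          refine (lintegral_sub_translate_rpow_le_two hp hum h).trans ?_
          gcongr
          exact le_self_add
        · refine (lintegral_sub_translate_rpow_le hp hu hg hw h).trans ?_
          rw [mul_comm]
          gcongr
          exact le_add_self.trans (le_mul_of_one_le_left zero_le h2)
    _ = _ := by
        have hm : Measurable fun h : Rd d => min 1 (‖h‖ₑ ^ p) * ν h :=
          Measurable.mul (by fun_prop) hν
        rw [lintegral_const_mul _ hm]
        ring

theorem energy_le (hp : 1 ≤ p) {ν : Rd d → ℝ≥0∞} (hν : Measurable ν) {u : Rd d → ℝ}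
    {g : Rd d → Rd d} (hu : MemLp u (ENNReal.ofReal p))
    (hg : MemLp g (ENNReal.ofReal p)) (hw : IsWeakGradient u g) :
    energy p ν u ≤ 2 ^ p * (∫⁻ h, min 1 (‖h‖ₑ ^ p) * ν h) *
      ((∫⁻ x, ‖u x‖ₑ ^ p) + ∫⁻ x, ‖g x‖ₑ ^ p) := by
  have hae := hu.1.ae_eq_mk
  have h := energy_le_of_measurable hp hν hu.1.stronglyMeasurable_mk.measurable (hu.ae_eq hae) hg
    (hw.congr_left hae)
  rw [energy_congr hae]
  refine h.trans (le_of_eq ?_)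
  rw [← eLpNorm_rpow_eq_lintegral hp, eLpNorm_congr_ae hae.symm, eLpNorm_rpow_eq_lintegral hp]

theorem ContinuouslyEmbeds.trans {X Y Z : (Rd d → ℝ) → Prop} {nX nY nZ : (Rd d → ℝ) → ℝ≥0∞}
    (h₁ : ContinuouslyEmbeds X nX Y nY) (h₂ : ContinuouslyEmbeds Y nY Z nZ) :
    ContinuouslyEmbeds X nX Z nZ := by
  obtain ⟨i₁, C₁, hC₁⟩ := h₁
  obtain ⟨i₂, C₂, hC₂⟩ := h₂
  refine ⟨fun u hu => i₂ u (i₁ u hu), C₂ * C₁, fun u hu => (hC₂ u (i₁ u hu)).trans ?_⟩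
  rw [ENNReal.coe_mul, mul_assoc]
  gcongr
  exact hC₁ u hu

theorem continuouslyEmbeds_sobolevOne_nonlocal (hp : 1 ≤ p) {ν : Rd d → ℝ≥0∞} (hν : Measurable ν)
    (hL : IsLevyIntegrable p ν) :
    ContinuouslyEmbeds (MemSobolevOne (d := d) p) (sobolevOneNorm p)
      (MemNonlocal p ν) (nonlocalNorm p ν) := by
  have hp0 : 0 < p := by linarith
  set c : ℝ≥0∞ := 2 ^ p * ∫⁻ h, min 1 (‖h‖ₑ ^ p) * ν h with hc
  have hctop : c < ∞ := ENNReal.mul_lt_top (ENNReal.rpow_lt_top_of_nonneg hp0.le (by simp)) hL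
  have hCtop : (1 + c) ^ (1 / p) ≠ ∞ := ENNReal.rpow_ne_top_of_nonneg (by positivity)
    (by finiteness)
  have hfin : ∀ {F : Type} [NormedAddCommGroup F] {v : Rd d → F}, MemLp v (ENNReal.ofReal p) →
      ∫⁻ x, ‖v x‖ₑ ^ p < ∞ := fun hv => by
    rw [← eLpNorm_rpow_eq_lintegral hp]
    exact ENNReal.rpow_lt_top_of_nonneg hp0.le hv.2.ne
  refine ⟨?_, ((1 + c) ^ (1 / p)).toNNReal, ?_⟩
  · rintro u ⟨hu, g, hg, hw⟩
    refine ⟨hu, ENNReal.rpow_lt_top_of_nonneg (by positivity) (ne_of_lt ?_)⟩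
    exact (energy_le hp hν hu hg hw).trans_lt
      (ENNReal.mul_lt_top hctop (ENNReal.add_lt_top.2 ⟨hfin hu, hfin hg⟩))
  · rintro u ⟨hu, -⟩
    have hC0 : (1 + c) ^ (1 / p) ≠ 0 :=
      (ENNReal.rpow_pos (by simp) (by finiteness)).ne'
    -- The norm is an infimum over weak gradients; the constant, nonzero and finite, moves inside,
    -- and the bound is proved for each gradient.
    rw [ENNReal.coe_toNNReal hCtop, sobolevOneNorm, ENNReal.mul_iInf_of_ne hC0 hCtop]
    refine le_iInf fun g => ?_
    rw [ENNReal.mul_iInf_of_ne hC0 hCtop]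
    refine le_iInf fun hg => ?_
    rw [← ENNReal.mul_rpow_of_nonneg _ _ (by positivity), one_div,
      ENNReal.le_rpow_inv_iff hp0, nonlocalNorm_rpow hp,
      eLpNorm_rpow_eq_lintegral hp, eLpNorm_rpow_eq_lintegral hp, add_mul, one_mul]
    exact add_le_add le_self_add (energy_le hp hν hu hg.1 hg.2)

end translation

end NonlocalSobolev

open NonlocalSobolev

theorem mainTheorem9 (d : ℕ) (hd : 1 ≤ d) (p : ℝ) (hp : 1 ≤ p) :
    (∀ ν : Rd d → ℝ≥0∞, Measurable ν → IsLevyIntegrable p ν →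
      Function.Bijective (wFun p ν) →
      IsYoungFunction (fun t => criticalFunction p ν (t ^ (1 / p))) →
      (∃ θ : ℝ≥0, 0 < θ ∧ ∀ s t : ℝ≥0∞, s ≤ t → 0 < t → t < ∞ →
        criticalFunction p ν (θ * (s / t)) ≤ criticalFunction p ν s / criticalFunction p ν t) →
      ∀ ψ : ℝ≥0∞ → ℝ≥0∞, IsYoungFunction ψ →
      (∃ c : ℝ≥0, 0 < c ∧ ∀ t : ℝ≥0∞, 0 < t → ψ (c * t) ≤ max (t ^ p) (criticalFunction p ν t)) →
      ContinuouslyEmbeds (MemNonlocal p ν) (nonlocalNorm p ν)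
          (MemOrlicz ψ) (luxemburgNorm ψ) ∧
        ContinuouslyEmbeds (MemSobolevOne (d := d) p) (sobolevOneNorm p)
          (MemOrlicz ψ) (luxemburgNorm ψ)) ∧
    (∀ s : ℝ, 0 < s → s < 1 → 0 < 1 / p - s / d →
      ∀ q : ℝ, p ≤ q → q ≤ (1 / p - s / d)⁻¹ →
      ContinuouslyEmbeds (MemNonlocal p (fractionalKernel d s p))
        (nonlocalNorm p (fractionalKernel d s p))
        (fun u => MemLp u (ENNReal.ofReal q) volume)
        (fun u => eLpNorm u (ENNReal.ofReal q) volume)) := by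
  refine ⟨fun ν hν hL hw hφ hθ ψ hψ ⟨c, hc0, hc⟩ => ?_, fun s hs _ hps q hpq hqr => ?_⟩
  · obtain ⟨A, hA⟩ := isSobolevGrowth_criticalFunction hd hp hν hw hφ hθ
    have h := hA.continuouslyEmbeds_orlicz hp hψ hc0 hc
    exact ⟨h, (continuouslyEmbeds_sobolevOne_nonlocal hp hν hL).trans h⟩
  · obtain ⟨A, K, hA⟩ := isSobolevGrowth_fractionalKernel hd hp hs hps
    exact hA.continuouslyEmbeds_eLpNorm hp hpq hqr
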